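/- Let $n\ge 2$ and $m\ge 3$ be integers and let $K$ be a field containing a primitive $m$-th root of unity $q$. Let $T_{m^2}(q)$ be the Taft Hopf algebra over $K$: it is generated as an algebra by $h,x$ subject to $h^m=1$, $x^m=0$, $xh=q\,hx$, with $\Delta(h)=h\otimes h$, $\Delta(x)=x\otimes h+1\otimes x$, $\varepsilon(h)=1$, $\varepsilon(x)=0$, $S(h)=h^{-1}$, $S(x)=-xh^{-1}$. Let $K[C_n]$ be the group Hopf algebra of the cyclic group of order $n$. Let $U_n(K)=\{\omega\in K : \omega^n=1\}$ and $\nu(n)=|U_n(K)|$. For $\omega\in U_n(K)$ let $T^{\omega}_{nm^2}=T^{\omega}_{nm^2}(q)$ be the Hopf algebra over $K$ generated as an algebra by $g,h,x$ subject to $$g^n=h^m=1,\quad x^m=0,\quad xh=q\,hx,\quad hg=gh,\quad gx=\omega\,xg,$$ with $\Delta(g)=g\otimes g$, $\Delta(h)=h\otimes h$, $\Delta(x)=x\otimes h+1\otimes x$, $\varepsilon(g)=\varepsilon(h)=1$, $\varepsilon(x)=0$, $S(g)=g^{n-1}$, $S(h)=h^{m-1}$, $S(x)=-xh^{m-1}$.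 A Hopf algebra $E$ over $K$ factorizes through Hopf algebras $A$ and $H$ if there are injective Hopf algebra maps $i\colon A\to E$ and $j\colon H\to E$ such that $A\otimes H\to E$, $a\otimes y\mapsto i(a)j(y)$, is bijective. Let $\xi$ be a generator of the cyclic group $U_n(K)$ and let $d=\gcd(m,\nu(n))$. Then: 1) For every $t\in\{0,1,\dots,\nu(n)-1\}$ there is an isomorphism of Hopf algebras $T^{\xi^{t}}_{nm^2}\cong T^{\xi^{\gcd(t,\,\nu(n)/d)}}_{nm^2}$. 2) If $d_1\ne d_2$ are positive divisors of $\nu(n)/d$, then the Hopf algebras $T^{\xi^{d_1}}_{nm^2}$ and $T^{\xi^{d_2}}_{nm^2}$ are not isomorphic. 3) If $\nu(n)/d=p_1^{\alpha_1}\cdots p_r^{\alpha_r}$ is the prime decomposition of $\nu(n)/d$, then the number of isomorphism types of Hopf algebras over $K$ that factorize through $T_{m^2}(q)$ and $K[C_n]$ equals $(\alpha_1+1)(\alpha_2+1)\cdots(\alpha_r+1)$ (which is $1$ when $\nu(n)/d=1$). -/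

import Mathlib

open scoped TensorProduct

universe u v

noncomputable section

/-! ### Two auxiliary facts: powers of a `q`-commuting sum, and antipodes on generators -/

/-- The `q`-integer `1 + q + ⋯ + q ^ (k - 1)`. -/
def qInt {K : Type u} [Field K] (q : K) (k : ℕ) : K := ∑ i ∈ Finset.range k, q ^ i

/-- The Gaussian binomial coefficient, through its Pascal rule. -/
def qBinom {K : Type u} [Field K] (q : K) : ℕ → ℕ → K
  | _, 0 => 1
  | 0, _ + 1 => 0
  | n + 1, k + 1 => qBinom q n (k + 1) + q ^ (n - k) * qBinom q n k

theorem qBinom_eq_zero {K : Type u} [Field K] (q : K) :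
    ∀ n k : ℕ, n < k → qBinom q n k = 0 := by
  intro n
  induction n with
  | zero => intro k hk; cases k with
    | zero => omega
    | succ k => simp [qBinom]
  | succ n ih => intro k hk; cases k with
    | zero => omega
    | succ k => simp [qBinom, ih (k + 1) (by omega), ih k (by omega)]

theorem qBinom_succ {K : Type u} [Field K] (q : K) (n k : ℕ) :
    qBinom q (n + 1) (k + 1) = qBinom q n (k + 1) + q ^ (n - k) * qBinom q n k := by
  rw [qBinom]

theorem qBinom_self {K : Type u} [Field K] (q : K) (n : ℕ) : qBinom q n n = 1 := by
  induction n with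
  | zero => simp [qBinom]
  | succ n ih => simp [qBinom_succ, ih, qBinom_eq_zero q n (n + 1) (by omega)]

theorem qInt_add {K : Type u} [Field K] (q : K) (a b : ℕ) :
    qInt q (a + b) = qInt q a + q ^ a * qInt q b := by
  simp [qInt, Finset.sum_range_add, pow_add, Finset.mul_sum]

theorem qInt_mul_qBinom {K : Type u} [Field K] (q : K) :
    ∀ n k : ℕ, qInt q (k + 1) * qBinom q n (k + 1) = qInt q (n - k) * qBinom q n k := by
  intro n
  induction n with
  | zero => intro k; simp [qBinom, qInt]
  | succ n ih =>
    intro k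
    rcases lt_trichotomy n k with h | h | h
    · rw [qBinom_eq_zero q (n + 1) (k + 1) (by omega)]
      simp [show n + 1 - k = 0 by omega, qInt]
    · subst h
      cases n with
      | zero => simp [qBinom, qInt]
      | succ k =>
        have h1 := ih k
        have h2 := qInt_add q 1 (k + 1)
        rw [show 1 + (k + 1) = k + 1 + 1 by omega] at h2
        have e1 : qInt q 1 = 1 := by simp [qInt]
        rw [qBinom_self, show k + 1 - k = 1 by omega, e1] at h1
        rw [e1] at h2
        rw [qBinom_self, qBinom_succ q (k + 1) k, qBinom_self, show k + 1 - k = 1 by omega,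
          show k + 1 + 1 - (k + 1) = 1 by omega, e1]
        linear_combination h2 + q * h1
    · cases k with
      | zero =>
        have h1 := ih 0
        have h2 := qInt_add q n 1
        simp only [qBinom, Nat.sub_zero, zero_add] at *
        simp only [qInt, Finset.sum_range_one, pow_zero] at *
        linear_combination h1 - h2
      | succ k =>
        obtain ⟨j, rfl⟩ := Nat.exists_eq_add_of_lt h
        have h1 := ih (k + 1)
        have h2 := ih k
        rw [qBinom_succ q (k + 1 + j + 1) (k + 1), qBinom_succ q (k + 1 + j + 1) k]
        rw [show k + 1 + j + 1 - (k + 1) = j + 1 by omega] at *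
        rw [show k + 1 + j + 1 - k = j + 2 by omega] at *
        rw [show k + 1 + j + 1 + 1 - (k + 1) = j + 2 by omega]
        have h3 := qInt_add q (j + 1) (k + 1 + 1)
        have h4 := qInt_add q (j + 2) (k + 1)
        rw [show j + 1 + (k + 1 + 1) = k + j + 3 by omega] at h3
        rw [show j + 2 + (k + 1) = k + j + 3 by omega] at h4
        have h5 := qInt_add q (j + 1) 1
        simp only [show j + 1 + 1 = j + 2 by omega] at h5
        linear_combination h1 + q ^ (j + 2) * h2 + qBinom q (k + 1 + j + 1) (k + 1) * (h4 - h3)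

theorem qBinom_primitive_eq_zero {K : Type u} [Field K] {q : K} {m : ℕ} (hq : IsPrimitiveRoot q m) :
    ∀ k : ℕ, 0 < k → k < m → qBinom q m k = 0 := by
  have hk : ∀ k : ℕ, 0 < k → k < m → qInt q k ≠ 0 := by
    intro k h0 h1 h
    have := mul_neg_geom_sum q k
    rw [qInt] at h
    rw [h, mul_zero] at this
    exact hq.pow_ne_one_of_pos_of_lt h0.ne' h1 (sub_eq_zero.1 this.symm).symm
  intro k
  induction k with
  | zero => intro h; omega
  | succ k ih =>
    intro _ h
    have h1 := qInt_mul_qBinom q m k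
    rcases Nat.eq_zero_or_pos k with rfl | hk0
    · have : qInt q m = 0 := by
        have := hq.geom_sum_eq_zero (by omega)
        exact this
      rw [Nat.sub_zero, this, zero_mul] at h1
      exact (mul_eq_zero.1 h1).resolve_left (hk _ (by omega) h)
    · rw [ih hk0 (by omega), mul_zero] at h1
      exact (mul_eq_zero.1 h1).resolve_left (hk _ (by omega) h)

theorem pow_mul_of_qCommute {K : Type u} [Field K] {R : Type v} [Ring R] [Algebra K R] {q : K}
    {a b : R} (h : b * a = q • (a * b)) (k : ℕ) : b ^ k * a = q ^ k • (a * b ^ k) := by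
  induction k with
  | zero => simp
  | succ k ih =>
    rw [pow_succ, mul_assoc, h, mul_smul_comm, ← mul_assoc, ih, smul_mul_assoc, smul_smul,
      mul_assoc, pow_succ, mul_comm]

theorem add_pow_of_qCommute {K : Type u} [Field K] {R : Type v} [Ring R] [Algebra K R] {q : K}
    {a b : R} (h : b * a = q • (a * b)) (n : ℕ) :
    (a + b) ^ n = ∑ k ∈ Finset.range (n + 1), qBinom q n k • (a ^ k * b ^ (n - k)) := by
  induction n with
  | zero => simp [qBinom]
  | succ n ih =>
    rw [pow_succ, ih, mul_add, Finset.sum_mul, Finset.sum_mul]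
    rw [Finset.sum_range_succ' _ (n + 1)]
    have e1 : ∀ k ∈ Finset.range (n + 1),
        qBinom q (n + 1) (k + 1) • (a ^ (k + 1) * b ^ (n + 1 - (k + 1)))
          = qBinom q n (k + 1) • (a ^ (k + 1) * b ^ (n - k))
            + qBinom q n k • (a ^ k * b ^ (n - k)) * a := by
      intro k _
      rw [smul_mul_assoc, mul_assoc, pow_mul_of_qCommute h, mul_smul_comm, smul_smul,
        ← mul_assoc, ← pow_succ, qBinom, add_smul, Nat.add_sub_add_right, mul_comm (q ^ _)]
    rw [Finset.sum_congr rfl e1, Finset.sum_add_distrib]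
    have e2 : ∑ k ∈ Finset.range (n + 1), qBinom q n k • (a ^ k * b ^ (n - k)) * b
        = (∑ k ∈ Finset.range (n + 1), qBinom q n (k + 1) • (a ^ (k + 1) * b ^ (n - k)))
          + b ^ (n + 1) := by
      rw [Finset.sum_range_succ' _ n, Finset.sum_range_succ _ n,
        qBinom_eq_zero q n (n + 1) (by omega)]
      simp only [zero_smul, add_zero, pow_zero, one_mul, Nat.sub_zero, smul_mul_assoc, mul_assoc,
        ← pow_succ]
      congr 1
      · refine Finset.sum_congr rfl fun k hk => ?_
        rw [Finset.mem_range] at hk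
        rw [show n - (k + 1) + 1 = n - k by omega]
      · cases n <;> simp [qBinom]
    rw [e2]
    simp only [qBinom, pow_zero, one_mul, Nat.sub_zero, one_smul]
    abel

/-- If `b a = q a b` with `q` a primitive `m`-th root of unity, then
`(a + b) ^ m = a ^ m + b ^ m`. -/
theorem add_pow_of_qCommute_primitive {K : Type u} [Field K] {R : Type v} [Ring R] [Algebra K R]
    {q : K} {m : ℕ} [NeZero m] (hq : IsPrimitiveRoot q m) {a b : R} (h : b * a = q • (a * b)) :
    (a + b) ^ m = a ^ m + b ^ m := by
  obtain ⟨l, rfl⟩ := Nat.exists_eq_succ_of_ne_zero (NeZero.ne m)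
  rw [add_pow_of_qCommute h, Finset.sum_range_succ, Finset.sum_range_succ']
  rw [Finset.sum_eq_zero]
  · have : qBinom q l.succ 0 = 1 := by simp [qBinom]
    rw [this, qBinom_self]
    simp [add_comm]
  · intro k hk
    rw [Finset.mem_range] at hk
    rw [qBinom_primitive_eq_zero hq (k + 1) (by omega) (by omega), zero_smul]

/-- An algebra map `A → Aᵐᵒᵖ`, viewed as a linear endomorphism of `A`. -/
def unopLin {K : Type u} [Field K] {A : Type v} [Ring A] [Algebra K A] (S : A →ₐ[K] Aᵐᵒᵖ) :
    A →ₗ[K] A :=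
  (MulOpposite.opLinearEquiv K).symm.toLinearMap ∘ₗ S.toLinearMap

theorem unopLin_apply {K : Type u} [Field K] {A : Type v} [Ring A] [Algebra K A]
    (S : A →ₐ[K] Aᵐᵒᵖ) (a : A) : unopLin S a = (S a).unop := rfl

theorem rTensor_mul_of_scalar {K : Type u} [Field K] {A : Type v} [Ring A] [Algebra K A]
    (S : A →ₐ[K] Aᵐᵒᵖ) {c : K} {X : A ⊗[K] A} (Y : A ⊗[K] A)
    (hX : LinearMap.mul' K A ((unopLin S).rTensor A X) = algebraMap K A c) :
    LinearMap.mul' K A ((unopLin S).rTensor A (X * Y)) =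
      c • LinearMap.mul' K A ((unopLin S).rTensor A Y) := by
  have key : ∀ (Z : A ⊗[K] A) (b b' : A),
      LinearMap.mul' K A ((unopLin S).rTensor A (Z * b ⊗ₜ b')) =
        unopLin S b * LinearMap.mul' K A ((unopLin S).rTensor A Z) * b' := by
    intro Z b b'
    induction Z with
    | zero => simp
    | tmul a a' => simp [unopLin_apply, mul_assoc]
    | add Z₁ Z₂ h₁ h₂ => simp only [add_mul, map_add, h₁, h₂, mul_add]
  induction Y with
  | zero => simp
  | tmul b b' =>
    rw [key, hX, ← Algebra.commutes, mul_assoc, ← Algebra.smul_def]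
    simp
  | add Y₁ Y₂ h₁ h₂ => simp only [mul_add, map_add, h₁, h₂, smul_add]

theorem lTensor_mul_of_scalar {K : Type u} [Field K] {A : Type v} [Ring A] [Algebra K A]
    (S : A →ₐ[K] Aᵐᵒᵖ) {c : K} (X : A ⊗[K] A) {Y : A ⊗[K] A}
    (hY : LinearMap.mul' K A ((unopLin S).lTensor A Y) = algebraMap K A c) :
    LinearMap.mul' K A ((unopLin S).lTensor A (X * Y)) =
      c • LinearMap.mul' K A ((unopLin S).lTensor A X) := by
  have key : ∀ (Z : A ⊗[K] A) (b b' : A),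
      LinearMap.mul' K A ((unopLin S).lTensor A (b ⊗ₜ b' * Z)) =
        b * LinearMap.mul' K A ((unopLin S).lTensor A Z) * unopLin S b' := by
    intro Z b b'
    induction Z with
    | zero => simp
    | tmul a a' => simp [unopLin_apply, mul_assoc]
    | add Z₁ Z₂ h₁ h₂ => simp only [add_mul, map_add, h₁, h₂, mul_add]
  induction X with
  | zero => simp
  | tmul b b' =>
    rw [key, hY, ← Algebra.commutes, mul_assoc, ← Algebra.smul_def]
    simp
  | add Y₁ Y₂ h₁ h₂ => simp only [add_mul, map_add, h₁, h₂, smul_add]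

/-- An anti-endomorphism of a bialgebra is an antipode as soon as it satisfies the antipode
identities on a set of algebra generators. -/
abbrev hopfAlgebraOfGenerators {K : Type u} [Field K] {A : Type v} [Ring A] [Bialgebra K A]
    (S : A →ₐ[K] Aᵐᵒᵖ) (s : Set A) (hs : Algebra.adjoin K s = ⊤)
    (hl : ∀ a ∈ s, LinearMap.mul' K A ((unopLin S).rTensor A (Coalgebra.comul a)) =
      algebraMap K A (Coalgebra.counit a))
    (hr : ∀ a ∈ s, LinearMap.mul' K A ((unopLin S).lTensor A (Coalgebra.comul a)) =
      algebraMap K A (Coalgebra.counit a)) : HopfAlgebra K A where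
  antipode := unopLin S
  mul_antipode_rTensor_comul := by
    ext a
    have ha : a ∈ Algebra.adjoin K s := hs ▸ Algebra.mem_top
    simp only [LinearMap.comp_apply, Algebra.linearMap_apply]
    induction ha using Algebra.adjoin_induction with
    | mem a h => exact hl a h
    | algebraMap r =>
      simp [Algebra.TensorProduct.algebraMap_apply, unopLin_apply]
    | add a b _ _ h₁ h₂ => simp only [map_add, h₁, h₂]
    | mul a b _ _ h₁ h₂ =>
      rw [Bialgebra.comul_mul, rTensor_mul_of_scalar S _ h₁, h₂, Bialgebra.counit_mul, map_mul,
        Algebra.smul_def]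
  mul_antipode_lTensor_comul := by
    ext a
    have ha : a ∈ Algebra.adjoin K s := hs ▸ Algebra.mem_top
    simp only [LinearMap.comp_apply, Algebra.linearMap_apply]
    induction ha using Algebra.adjoin_induction with
    | mem a h => exact hr a h
    | algebraMap r =>
      simp [Algebra.TensorProduct.algebraMap_apply, unopLin_apply]
    | add a b _ _ h₁ h₂ => simp only [map_add, h₁, h₂]
    | mul a b _ _ h₁ h₂ =>
      rw [Bialgebra.comul_mul, lTensor_mul_of_scalar S _ h₂, h₁, Bialgebra.counit_mul, map_mul,
        Algebra.smul_def, Algebra.commutes]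

/-! ### Consequences of the defining relations, in an arbitrary algebra -/

theorem hPow_mul_x {K : Type u} [Field K] {R : Type v} [Ring R] [Algebra K R] {q : K} {m : ℕ}
    [NeZero m] (hq : IsPrimitiveRoot q m) {h x : R} (hxh : x * h = q • (h * x)) :
    h ^ (m - 1) * x = q • (x * h ^ (m - 1)) := by
  have key : ∀ k : ℕ, x * h ^ k = q ^ k • (h ^ k * x) := by
    intro k
    induction k with
    | zero => simp
    | succ k ih =>
      rw [pow_succ, ← mul_assoc, ih, smul_mul_assoc, mul_assoc, hxh, mul_smul_comm, smul_smul,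
        ← mul_assoc, pow_succ]
  have hm : q * q ^ (m - 1) = 1 := by
    rw [← pow_succ', Nat.sub_add_cancel (NeZero.pos m), hq.pow_eq_one]
  rw [key, smul_smul, hm, one_smul]

theorem neg_mul_pow_eq_zero {K : Type u} [Field K] {R : Type v} [Ring R] [Algebra K R] {c : K}
    {m : ℕ} {x y : R} (hyx : y * x = c • (x * y)) (hx : x ^ m = 0) : (-(x * y)) ^ m = 0 := by
  have key : ∀ k : ℕ, ∃ e : K, (x * y) ^ k = e • (x ^ k * y ^ k) := by
    intro k
    induction k with
    | zero => exact ⟨1, by simp⟩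
    | succ k ih =>
      obtain ⟨e, he⟩ := ih
      refine ⟨e * c ^ k, ?_⟩
      rw [pow_succ, he, smul_mul_assoc, mul_assoc, ← mul_assoc (y ^ k), pow_mul_of_qCommute hyx,
        smul_mul_assoc, mul_smul_comm, smul_smul, pow_succ, pow_succ]
      simp only [mul_assoc]
  obtain ⟨e, he⟩ := key m
  rw [neg_pow, he, hx]
  simp

theorem pow_pred_mul_self {R : Type v} [Ring R] {n : ℕ} [NeZero n] {g : R} (hg : g ^ n = 1) :
    g ^ (n - 1) * g = 1 := by
  rw [← pow_succ, Nat.sub_add_cancel (NeZero.pos n), hg]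

theorem self_mul_pow_pred {R : Type v} [Ring R] {n : ℕ} [NeZero n] {g : R} (hg : g ^ n = 1) :
    g * g ^ (n - 1) = 1 := by
  rw [← pow_succ', Nat.sub_add_cancel (NeZero.pos n), hg]

theorem pow_pred_pow {R : Type v} [Ring R] {n : ℕ} {g : R} (hg : g ^ n = 1) :
    (g ^ (n - 1)) ^ n = 1 := by
  rw [← pow_mul, mul_comm, pow_mul, hg, one_pow]

theorem x_mul_gPow {K : Type u} [Field K] {R : Type v} [Ring R] [Algebra K R] {ω : K} {n : ℕ}
    [NeZero n] {g x : R} (hg : g ^ n = 1) (hgx : g * x = ω • (x * g)) :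
    x * g ^ (n - 1) = ω • (g ^ (n - 1) * x) := by
  calc x * g ^ (n - 1) = g ^ (n - 1) * (g * x) * g ^ (n - 1) := by
        rw [← mul_assoc, pow_pred_mul_self hg, one_mul]
    _ = ω • (g ^ (n - 1) * x) := by
        rw [hgx, mul_smul_comm, smul_mul_assoc, mul_assoc, mul_assoc, self_mul_pow_pred hg,
          mul_one]

theorem x_comul_pow {K : Type u} [Field K] {R : Type v} [Ring R] [Algebra K R] {q : K} {m : ℕ}
    [NeZero m] (hq : IsPrimitiveRoot q m) {h x : R} (hx : x ^ m = 0) (hxh : x * h = q • (h * x)) :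
    (x ⊗ₜ[K] h + 1 ⊗ₜ[K] x) ^ m = 0 := by
  rw [add_pow_of_qCommute_primitive hq]
  · simp [Algebra.TensorProduct.tmul_pow, hx]
  · simp [Algebra.TensorProduct.tmul_mul_tmul, hxh]

theorem x_comul_h {K : Type u} [Field K] {R : Type v} [Ring R] [Algebra K R] {q : K}
    {h x : R} (hxh : x * h = q • (h * x)) :
    (x ⊗ₜ[K] h + 1 ⊗ₜ[K] x) * h ⊗ₜ[K] h = q • (h ⊗ₜ[K] h * (x ⊗ₜ[K] h + 1 ⊗ₜ[K] x)) := by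
  simp [add_mul, mul_add, Algebra.TensorProduct.tmul_mul_tmul, hxh, TensorProduct.smul_tmul']

theorem h_comul_g {K : Type u} [Field K] {R : Type v} [Ring R] [Algebra K R] {g h : R}
    (hhg : h * g = g * h) : h ⊗ₜ[K] h * g ⊗ₜ[K] g = g ⊗ₜ[K] g * h ⊗ₜ[K] h := by
  simp [Algebra.TensorProduct.tmul_mul_tmul, hhg]

theorem g_comul_x {K : Type u} [Field K] {R : Type v} [Ring R] [Algebra K R] {ω : K}
    {g h x : R} (hhg : h * g = g * h) (hgx : g * x = ω • (x * g)) :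
    g ⊗ₜ[K] g * (x ⊗ₜ[K] h + 1 ⊗ₜ[K] x) = ω • ((x ⊗ₜ[K] h + 1 ⊗ₜ[K] x) * g ⊗ₜ[K] g) := by
  simp [add_mul, mul_add, Algebra.TensorProduct.tmul_mul_tmul, hhg, hgx,
    TensorProduct.smul_tmul']

/-! ### The Taft Hopf algebra `T_{m²}(q)` -/

/-- The generators `h`, `x` of the Taft algebra. -/
inductive TaftGen
  | h
  | x

/-- The relations `h ^ m = 1`, `x ^ m = 0`, `x h = q h x` of the Taft algebra. -/
inductive TaftRel (K : Type u) [Field K] (m : ℕ) (q : K) :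
    FreeAlgebra K TaftGen → FreeAlgebra K TaftGen → Prop
  | h_pow : TaftRel K m q (FreeAlgebra.ι K TaftGen.h ^ m) 1
  | x_pow : TaftRel K m q (FreeAlgebra.ι K TaftGen.x ^ m) 0
  | x_mul_h : TaftRel K m q (FreeAlgebra.ι K TaftGen.x * FreeAlgebra.ι K TaftGen.h)
      (q • (FreeAlgebra.ι K TaftGen.h * FreeAlgebra.ι K TaftGen.x))

/-- The Taft algebra `T_{m²}(q)`: the `K`-algebra generated by `h`, `x` subject to `h ^ m = 1`,
`x ^ m = 0`, `x h = q h x`. -/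
def Taft (K : Type u) [Field K] (m : ℕ) (q : K) : Type u := RingQuot (TaftRel K m q)

namespace Taft

variable (K : Type u) [Field K] (m : ℕ) (q : K)

instance : Ring (Taft K m q) := inferInstanceAs (Ring (RingQuot (TaftRel K m q)))

instance : Algebra K (Taft K m q) := inferInstanceAs (Algebra K (RingQuot (TaftRel K m q)))

/-- The quotient map from the free algebra. -/
def mk : FreeAlgebra K TaftGen →ₐ[K] Taft K m q := RingQuot.mkAlgHom K (TaftRel K m q)

/-- The generator `h`. -/
def h : Taft K m q := mk K m q (FreeAlgebra.ι K TaftGen.h)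

/-- The generator `x`. -/
def x : Taft K m q := mk K m q (FreeAlgebra.ι K TaftGen.x)

theorem h_pow : h K m q ^ m = 1 := by
  simpa [h, mk] using! RingQuot.mkAlgHom_rel K (TaftRel.h_pow (K := K) (m := m) (q := q))

theorem x_pow : x K m q ^ m = 0 := by
  simpa [x, mk] using! RingQuot.mkAlgHom_rel K (TaftRel.x_pow (K := K) (m := m) (q := q))

theorem x_mul_h : x K m q * h K m q = q • (h K m q * x K m q) := by
  simpa [x, h, mk] using! RingQuot.mkAlgHom_rel K (TaftRel.x_mul_h (K := K) (m := m) (q := q))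

theorem adjoin_eq_top : Algebra.adjoin K {h K m q, x K m q} = ⊤ := by
  have hs : Function.Surjective (mk K m q) := RingQuot.mkAlgHom_surjective K _
  rw [← (AlgHom.range_eq_top (mk K m q)).2 hs, ← Algebra.map_top,
    ← FreeAlgebra.adjoin_range_ι, AlgHom.map_adjoin]
  congr 1
  ext y
  constructor
  · rintro (rfl | rfl)
    · exact ⟨_, ⟨_, rfl⟩, rfl⟩
    · exact ⟨_, ⟨_, rfl⟩, rfl⟩
  · rintro ⟨_, ⟨i, rfl⟩, rfl⟩
    cases i
    · exact Or.inl rfl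
    · exact Or.inr rfl

variable {K m q}

/-- The universal property: elements satisfying the relations define an algebra map. -/
def lift {B : Type v} [Ring B] [Algebra K B] (b y : B) (h_pow : b ^ m = 1) (x_pow : y ^ m = 0)
    (x_mul_h : y * b = q • (b * y)) : Taft K m q →ₐ[K] B :=
  RingQuot.liftAlgHom K ⟨FreeAlgebra.lift K (fun i => match i with | .h => b | .x => y), by
    intro a c hac
    cases hac <;> simp [h_pow, x_pow, x_mul_h]⟩

section lift

variable {B : Type v} [Ring B] [Algebra K B] {b y : B} (h_pow : b ^ m = 1) (x_pow : y ^ m = 0)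
  (x_mul_h : y * b = q • (b * y))

@[simp] theorem lift_h : lift b y h_pow x_pow x_mul_h (h K m q) = b :=
  (RingQuot.liftAlgHom_mkAlgHom_apply _ _ _ _).trans (by simp)

@[simp] theorem lift_x : lift b y h_pow x_pow x_mul_h (x K m q) = y :=
  (RingQuot.liftAlgHom_mkAlgHom_apply _ _ _ _).trans (by simp)

theorem algHom_ext {f f' : Taft K m q →ₐ[K] B} (hh : f (h K m q) = f' (h K m q))
    (hx : f (x K m q) = f' (x K m q)) : f = f' := by
  refine AlgHom.ext_of_adjoin_eq_top (adjoin_eq_top K m q) ?_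
  rintro _ (rfl | rfl)
  · exact hh
  · exact hx

end lift

variable [NeZero m] [hq : Fact (IsPrimitiveRoot q m)]

/-- `Δ(h) = h ⊗ h`, `Δ(x) = x ⊗ h + 1 ⊗ x`, `ε(h) = 1`, `ε(x) = 0`. -/
instance : Bialgebra K (Taft K m q) :=
  Bialgebra.ofAlgHom
    (lift (h K m q ⊗ₜ h K m q) (x K m q ⊗ₜ h K m q + 1 ⊗ₜ x K m q)
      (by rw [Algebra.TensorProduct.tmul_pow, h_pow, Algebra.TensorProduct.one_def])
      (x_comul_pow hq.out (x_pow K m q) (x_mul_h K m q))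
      (x_comul_h (x_mul_h K m q)))
    (lift 1 0 (one_pow m) (zero_pow (NeZero.ne m)) (by simp))
    (algHom_ext (by simp)
      (by simp [TensorProduct.add_tmul, TensorProduct.tmul_add, Algebra.TensorProduct.one_def,
        add_assoc]))
    (algHom_ext (by simp) (by simp))
    (algHom_ext (by simp) (by simp))

@[simp] theorem comul_h : Coalgebra.comul (R := K) (h K m q) = h K m q ⊗ₜ h K m q :=
  lift_h _ _ _

@[simp] theorem comul_x :
    Coalgebra.comul (R := K) (x K m q) = x K m q ⊗ₜ h K m q + 1 ⊗ₜ x K m q :=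
  lift_x _ _ _

@[simp] theorem counit_h : Coalgebra.counit (R := K) (h K m q) = 1 := lift_h _ _ _

@[simp] theorem counit_x : Coalgebra.counit (R := K) (x K m q) = 0 := lift_x _ _ _

/-- The antipode `S(h) = h⁻¹ = h ^ (m - 1)`, `S(x) = - x h⁻¹`, as an algebra map to the opposite
algebra. -/
def antipodeAlgHom : Taft K m q →ₐ[K] (Taft K m q)ᵐᵒᵖ :=
  lift (MulOpposite.op (h K m q ^ (m - 1))) (MulOpposite.op (-(x K m q * h K m q ^ (m - 1))))
    (by rw [← MulOpposite.op_pow, pow_pred_pow (h_pow K m q), MulOpposite.op_one])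
    (by rw [← MulOpposite.op_pow,
          neg_mul_pow_eq_zero (hPow_mul_x hq.out (x_mul_h K m q)) (x_pow K m q),
          MulOpposite.op_zero])
    (by rw [← MulOpposite.op_mul, ← MulOpposite.op_mul, ← MulOpposite.op_smul, mul_neg,
          ← mul_assoc, hPow_mul_x hq.out (x_mul_h K m q), neg_mul, smul_mul_assoc, smul_neg])

/-- The Hopf algebra structure of the Taft algebra. -/
instance : HopfAlgebra K (Taft K m q) :=
  hopfAlgebraOfGenerators antipodeAlgHom _ (adjoin_eq_top K m q)
    (by
      rintro _ (rfl | rfl)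
      · simp [unopLin_apply, antipodeAlgHom, pow_pred_mul_self (h_pow K m q)]
      · simp [unopLin_apply, antipodeAlgHom, mul_assoc, pow_pred_mul_self (h_pow K m q)])
    (by
      rintro _ (rfl | rfl)
      · simp [unopLin_apply, antipodeAlgHom, self_mul_pow_pred (h_pow K m q)]
      · simp [unopLin_apply, antipodeAlgHom])

@[simp] theorem antipode_h : HopfAlgebra.antipode K (h K m q) = h K m q ^ (m - 1) := by
  change unopLin antipodeAlgHom _ = _
  simp [unopLin_apply, antipodeAlgHom]

@[simp] theorem antipode_x :
    HopfAlgebra.antipode K (x K m q) = -(x K m q * h K m q ^ (m - 1)) := by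
  change unopLin antipodeAlgHom _ = _
  simp [unopLin_apply, antipodeAlgHom]

end Taft

/-! ### The Hopf algebras `T_{nm²}^ω(q)` -/

/-- The generators `g`, `h`, `x` of `T_{nm²}^ω(q)`. -/
inductive CyclicTaftGen
  | g
  | h
  | x

/-- The relations `g ^ n = h ^ m = 1`, `x ^ m = 0`, `x h = q h x`, `h g = g h`, `g x = ω x g`. -/
inductive CyclicTaftRel (K : Type u) [Field K] (n m : ℕ) (q ω : K) :
    FreeAlgebra K CyclicTaftGen → FreeAlgebra K CyclicTaftGen → Prop
  | g_pow : CyclicTaftRel K n m q ω (FreeAlgebra.ι K CyclicTaftGen.g ^ n) 1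
  | h_pow : CyclicTaftRel K n m q ω (FreeAlgebra.ι K CyclicTaftGen.h ^ m) 1
  | x_pow : CyclicTaftRel K n m q ω (FreeAlgebra.ι K CyclicTaftGen.x ^ m) 0
  | x_mul_h : CyclicTaftRel K n m q ω
      (FreeAlgebra.ι K CyclicTaftGen.x * FreeAlgebra.ι K CyclicTaftGen.h)
      (q • (FreeAlgebra.ι K CyclicTaftGen.h * FreeAlgebra.ι K CyclicTaftGen.x))
  | h_mul_g : CyclicTaftRel K n m q ω
      (FreeAlgebra.ι K CyclicTaftGen.h * FreeAlgebra.ι K CyclicTaftGen.g)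
      (FreeAlgebra.ι K CyclicTaftGen.g * FreeAlgebra.ι K CyclicTaftGen.h)
  | g_mul_x : CyclicTaftRel K n m q ω
      (FreeAlgebra.ι K CyclicTaftGen.g * FreeAlgebra.ι K CyclicTaftGen.x)
      (ω • (FreeAlgebra.ι K CyclicTaftGen.x * FreeAlgebra.ι K CyclicTaftGen.g))

/-- The algebra `T_{nm²}^ω(q)`: generated by `g`, `h`, `x` subject to `g ^ n = h ^ m = 1`,
`x ^ m = 0`, `x h = q h x`, `h g = g h`, `g x = ω x g`. -/
def CyclicTaft (K : Type u) [Field K] (n m : ℕ) (q ω : K) : Type u :=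
  RingQuot (CyclicTaftRel K n m q ω)

namespace CyclicTaft

variable (K : Type u) [Field K] (n m : ℕ) (q ω : K)

instance : Ring (CyclicTaft K n m q ω) :=
  inferInstanceAs (Ring (RingQuot (CyclicTaftRel K n m q ω)))

instance : Algebra K (CyclicTaft K n m q ω) :=
  inferInstanceAs (Algebra K (RingQuot (CyclicTaftRel K n m q ω)))

/-- The quotient map from the free algebra. -/
def mk : FreeAlgebra K CyclicTaftGen →ₐ[K] CyclicTaft K n m q ω :=
  RingQuot.mkAlgHom K (CyclicTaftRel K n m q ω)

/-- The generator `g`. -/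
def g : CyclicTaft K n m q ω := mk K n m q ω (FreeAlgebra.ι K CyclicTaftGen.g)

/-- The generator `h`. -/
def h : CyclicTaft K n m q ω := mk K n m q ω (FreeAlgebra.ι K CyclicTaftGen.h)

/-- The generator `x`. -/
def x : CyclicTaft K n m q ω := mk K n m q ω (FreeAlgebra.ι K CyclicTaftGen.x)

theorem g_pow : g K n m q ω ^ n = 1 := by
  simpa [g, mk] using! RingQuot.mkAlgHom_rel K
    (CyclicTaftRel.g_pow (K := K) (n := n) (m := m) (q := q) (ω := ω))

theorem h_pow : h K n m q ω ^ m = 1 := by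
  simpa [h, mk] using! RingQuot.mkAlgHom_rel K
    (CyclicTaftRel.h_pow (K := K) (n := n) (m := m) (q := q) (ω := ω))

theorem x_pow : x K n m q ω ^ m = 0 := by
  simpa [x, mk] using! RingQuot.mkAlgHom_rel K
    (CyclicTaftRel.x_pow (K := K) (n := n) (m := m) (q := q) (ω := ω))

theorem x_mul_h : x K n m q ω * h K n m q ω = q • (h K n m q ω * x K n m q ω) := by
  simpa [x, h, mk] using! RingQuot.mkAlgHom_rel K
    (CyclicTaftRel.x_mul_h (K := K) (n := n) (m := m) (q := q) (ω := ω))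

theorem h_mul_g : h K n m q ω * g K n m q ω = g K n m q ω * h K n m q ω := by
  simpa [g, h, mk] using! RingQuot.mkAlgHom_rel K
    (CyclicTaftRel.h_mul_g (K := K) (n := n) (m := m) (q := q) (ω := ω))

theorem g_mul_x : g K n m q ω * x K n m q ω = ω • (x K n m q ω * g K n m q ω) := by
  simpa [g, x, mk] using! RingQuot.mkAlgHom_rel K
    (CyclicTaftRel.g_mul_x (K := K) (n := n) (m := m) (q := q) (ω := ω))

theorem adjoin_eq_top :
    Algebra.adjoin K {g K n m q ω, h K n m q ω, x K n m q ω} = ⊤ := by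
  have hs : Function.Surjective (mk K n m q ω) := RingQuot.mkAlgHom_surjective K _
  rw [← (AlgHom.range_eq_top (mk K n m q ω)).2 hs, ← Algebra.map_top,
    ← FreeAlgebra.adjoin_range_ι, AlgHom.map_adjoin]
  congr 1
  ext y
  constructor
  · rintro (rfl | rfl | rfl)
    · exact ⟨_, ⟨_, rfl⟩, rfl⟩
    · exact ⟨_, ⟨_, rfl⟩, rfl⟩
    · exact ⟨_, ⟨_, rfl⟩, rfl⟩
  · rintro ⟨_, ⟨i, rfl⟩, rfl⟩
    cases i
    · exact Or.inl rfl
    · exact Or.inr (Or.inl rfl)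
    · exact Or.inr (Or.inr rfl)

variable {K n m q ω}

/-- The universal property: elements satisfying the relations define an algebra map. -/
def lift {B : Type v} [Ring B] [Algebra K B] (c b y : B) (g_pow : c ^ n = 1) (h_pow : b ^ m = 1)
    (x_pow : y ^ m = 0) (x_mul_h : y * b = q • (b * y)) (h_mul_g : b * c = c * b)
    (g_mul_x : c * y = ω • (y * c)) : CyclicTaft K n m q ω →ₐ[K] B :=
  RingQuot.liftAlgHom K
    ⟨FreeAlgebra.lift K (fun i => match i with | .g => c | .h => b | .x => y), by
      intro a d had
      cases had <;> simp [g_pow, h_pow, x_pow, x_mul_h, h_mul_g, g_mul_x]⟩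

section lift

variable {B : Type v} [Ring B] [Algebra K B] {c b y : B} (g_pow : c ^ n = 1) (h_pow : b ^ m = 1)
  (x_pow : y ^ m = 0) (x_mul_h : y * b = q • (b * y)) (h_mul_g : b * c = c * b)
  (g_mul_x : c * y = ω • (y * c))

@[simp] theorem lift_g :
    lift c b y g_pow h_pow x_pow x_mul_h h_mul_g g_mul_x (g K n m q ω) = c :=
  (RingQuot.liftAlgHom_mkAlgHom_apply _ _ _ _).trans (by simp)

@[simp] theorem lift_h :
    lift c b y g_pow h_pow x_pow x_mul_h h_mul_g g_mul_x (h K n m q ω) = b :=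
  (RingQuot.liftAlgHom_mkAlgHom_apply _ _ _ _).trans (by simp)

@[simp] theorem lift_x :
    lift c b y g_pow h_pow x_pow x_mul_h h_mul_g g_mul_x (x K n m q ω) = y :=
  (RingQuot.liftAlgHom_mkAlgHom_apply _ _ _ _).trans (by simp)

theorem algHom_ext {f f' : CyclicTaft K n m q ω →ₐ[K] B}
    (hg : f (g K n m q ω) = f' (g K n m q ω)) (hh : f (h K n m q ω) = f' (h K n m q ω))
    (hx : f (x K n m q ω) = f' (x K n m q ω)) : f = f' := by
  refine AlgHom.ext_of_adjoin_eq_top (adjoin_eq_top K n m q ω) ?_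
  rintro _ (rfl | rfl | rfl)
  · exact hg
  · exact hh
  · exact hx

end lift

variable [NeZero m] [hq : Fact (IsPrimitiveRoot q m)]

/-- `Δ(g) = g ⊗ g`, `Δ(h) = h ⊗ h`, `Δ(x) = x ⊗ h + 1 ⊗ x`, `ε(g) = ε(h) = 1`, `ε(x) = 0`.
The index `ω` enters as an arbitrary scalar; the Hopf algebras of interest have `ω ^ n = 1`. -/
instance : Bialgebra K (CyclicTaft K n m q ω) :=
  Bialgebra.ofAlgHom
    (lift (g K n m q ω ⊗ₜ g K n m q ω) (h K n m q ω ⊗ₜ h K n m q ω)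
      (x K n m q ω ⊗ₜ h K n m q ω + 1 ⊗ₜ x K n m q ω)
      (by rw [Algebra.TensorProduct.tmul_pow, g_pow, Algebra.TensorProduct.one_def])
      (by rw [Algebra.TensorProduct.tmul_pow, h_pow, Algebra.TensorProduct.one_def])
      (x_comul_pow hq.out (x_pow K n m q ω) (x_mul_h K n m q ω))
      (x_comul_h (x_mul_h K n m q ω))
      (h_comul_g (h_mul_g K n m q ω))
      (g_comul_x (h_mul_g K n m q ω) (g_mul_x K n m q ω)))
    (lift 1 1 0 (one_pow n) (one_pow m) (zero_pow (NeZero.ne m)) (by simp) (by simp) (by simp))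
    (algHom_ext (by simp) (by simp)
      (by simp [TensorProduct.add_tmul, TensorProduct.tmul_add, Algebra.TensorProduct.one_def,
        add_assoc]))
    (algHom_ext (by simp) (by simp) (by simp))
    (algHom_ext (by simp) (by simp) (by simp))

@[simp] theorem comul_g :
    Coalgebra.comul (R := K) (g K n m q ω) = g K n m q ω ⊗ₜ g K n m q ω :=
  lift_g _ _ _ _ _ _

@[simp] theorem comul_h :
    Coalgebra.comul (R := K) (h K n m q ω) = h K n m q ω ⊗ₜ h K n m q ω :=
  lift_h _ _ _ _ _ _

@[simp] theorem comul_x :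
    Coalgebra.comul (R := K) (x K n m q ω) = x K n m q ω ⊗ₜ h K n m q ω + 1 ⊗ₜ x K n m q ω :=
  lift_x _ _ _ _ _ _

@[simp] theorem counit_g : Coalgebra.counit (R := K) (g K n m q ω) = 1 := lift_g _ _ _ _ _ _

@[simp] theorem counit_h : Coalgebra.counit (R := K) (h K n m q ω) = 1 := lift_h _ _ _ _ _ _

@[simp] theorem counit_x : Coalgebra.counit (R := K) (x K n m q ω) = 0 := lift_x _ _ _ _ _ _

variable [NeZero n]

/-- The antipode `S(g) = g ^ (n - 1)`, `S(h) = h ^ (m - 1)`, `S(x) = - x h ^ (m - 1)`, as an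
algebra map to the opposite algebra. -/
def antipodeAlgHom : CyclicTaft K n m q ω →ₐ[K] (CyclicTaft K n m q ω)ᵐᵒᵖ :=
  lift (MulOpposite.op (g K n m q ω ^ (n - 1))) (MulOpposite.op (h K n m q ω ^ (m - 1)))
    (MulOpposite.op (-(x K n m q ω * h K n m q ω ^ (m - 1))))
    (by rw [← MulOpposite.op_pow, pow_pred_pow (g_pow K n m q ω), MulOpposite.op_one])
    (by rw [← MulOpposite.op_pow, pow_pred_pow (h_pow K n m q ω), MulOpposite.op_one])
    (by rw [← MulOpposite.op_pow,
          neg_mul_pow_eq_zero (hPow_mul_x hq.out (x_mul_h K n m q ω)) (x_pow K n m q ω),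
          MulOpposite.op_zero])
    (by rw [← MulOpposite.op_mul, ← MulOpposite.op_mul, ← MulOpposite.op_smul, mul_neg,
          ← mul_assoc, hPow_mul_x hq.out (x_mul_h K n m q ω), neg_mul, smul_mul_assoc, smul_neg])
    (by rw [← MulOpposite.op_mul, ← MulOpposite.op_mul,
          ((show Commute (h K n m q ω) (g K n m q ω) from h_mul_g K n m q ω).pow_pow _ _).eq])
    (by rw [← MulOpposite.op_mul, ← MulOpposite.op_mul, ← MulOpposite.op_smul, mul_neg, neg_mul,
          mul_assoc,
          ((show Commute (h K n m q ω) (g K n m q ω) from h_mul_g K n m q ω).pow_pow _ _).eq,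
          ← mul_assoc, x_mul_gPow (g_pow K n m q ω) (g_mul_x K n m q ω), smul_mul_assoc,
          smul_neg, mul_assoc])

/-- The Hopf algebra structure of `T_{nm²}^ω(q)`. -/
instance : HopfAlgebra K (CyclicTaft K n m q ω) :=
  hopfAlgebraOfGenerators antipodeAlgHom _ (adjoin_eq_top K n m q ω)
    (by
      rintro _ (rfl | rfl | rfl)
      · simp [unopLin_apply, antipodeAlgHom, pow_pred_mul_self (g_pow K n m q ω)]
      · simp [unopLin_apply, antipodeAlgHom, pow_pred_mul_self (h_pow K n m q ω)]
      · simp [unopLin_apply, antipodeAlgHom, mul_assoc, pow_pred_mul_self (h_pow K n m q ω)])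
    (by
      rintro _ (rfl | rfl | rfl)
      · simp [unopLin_apply, antipodeAlgHom, self_mul_pow_pred (g_pow K n m q ω)]
      · simp [unopLin_apply, antipodeAlgHom, self_mul_pow_pred (h_pow K n m q ω)]
      · simp [unopLin_apply, antipodeAlgHom])

@[simp] theorem antipode_g : HopfAlgebra.antipode K (g K n m q ω) = g K n m q ω ^ (n - 1) := by
  change unopLin antipodeAlgHom _ = _
  simp [unopLin_apply, antipodeAlgHom]

@[simp] theorem antipode_h : HopfAlgebra.antipode K (h K n m q ω) = h K n m q ω ^ (m - 1) := by
  change unopLin antipodeAlgHom _ = _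
  simp [unopLin_apply, antipodeAlgHom]

@[simp] theorem antipode_x :
    HopfAlgebra.antipode K (x K n m q ω) = -(x K n m q ω * h K n m q ω ^ (m - 1)) := by
  change unopLin antipodeAlgHom _ = _
  simp [unopLin_apply, antipodeAlgHom]

end CyclicTaft

/-! ### Factorizations and isomorphism types -/

/-- The Hopf algebra `E` factorizes through the Hopf algebras `A` and `H`: there are injective Hopf
algebra maps `i : A → E` and `j : H → E` such that `A ⊗ H → E`, `a ⊗ y ↦ i(a) j(y)`, is bijective.
(Bialgebra maps between Hopf algebras automatically commute with the antipodes.) -/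
def FactorizesThrough (K : Type u) [Field K] (A H E : Type*) [Ring A] [Ring H] [Ring E]
    [HopfAlgebra K A] [HopfAlgebra K H] [HopfAlgebra K E] : Prop :=
  ∃ (i : A →ₐc[K] E) (j : H →ₐc[K] E), Function.Injective i ∧ Function.Injective j ∧
    Function.Bijective (LinearMap.mul' K E ∘ₗ
      TensorProduct.map (i : A →ₐ[K] E).toLinearMap (j : H →ₐ[K] E).toLinearMap)

/-- Isomorphism of Hopf algebras, as an equivalence relation on the Hopf algebras that factorize
through `A` and `H`. -/
def factorizingSetoid (K : Type u) [Field K] (A H : Type*) [Ring A] [Ring H]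
    [HopfAlgebra K A] [HopfAlgebra K H] :
    Setoid {E : HopfAlgCat.{v} K // FactorizesThrough K A H E} where
  r E F := Nonempty (E.1 ≃ₐc[K] F.1)
  iseqv := ⟨fun E => ⟨BialgEquiv.refl K E.1⟩, fun ⟨e⟩ => ⟨e.symm⟩,
    fun ⟨e⟩ ⟨f⟩ => ⟨e.trans f⟩⟩

/-- The isomorphism types of Hopf algebras over `K` that factorize through `A` and `H`. The
underlying types range over the universe `v`; when `A` and `H` live in the universe of `K`, taking
that universe for `v` misses no type, as `E` is in bijection with `A ⊗ H`. -/
def FactorizingTypes (K : Type u) [Field K] (A H : Type*) [Ring A] [Ring H]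
    [HopfAlgebra K A] [HopfAlgebra K H] : Type _ :=
  Quotient (factorizingSetoid.{u, v} K A H)

/-- `ν(n)`, the order of the group `U_n(K)` of `n`-th roots of unity in `K`. -/
def nu (K : Type u) [Field K] (n : ℕ) : ℕ := Nat.card (rootsOfUnity n K)

/-- The group Hopf algebra `K[C_n]` of the cyclic group of order `n`. -/
abbrev CyclicGroupAlgebra (K : Type u) [Field K] (n : ℕ) : Type u :=
  MonoidAlgebra K (Multiplicative (ZMod n))

end

/-! If $E$ factorizes through $T_{m^2}(q)$ and $K[C_n]$, the images of the generators give
group-likes $g,h$ and a skew-primitive $x$ whose monomials $h^a x^b g^c$ form a basis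
(`FactorizesThrough.exists_taftBasis`). This already fixes the coalgebra: by the $q$-binomial
theorem $\Delta$ is explicit on monomials, whatever the relations between $g$ and $h,x$ may be.
Comparing coefficients shows that the group-likes are exactly the $h^a g^c$, and that an element $y$
with $\Delta(y)=y\otimes u+1\otimes y$ outside their span forces $u=h$ and $y=\alpha x+z$ with $z$
in that span (`TaftBasis.skewPrimitive`). If $y$ moreover $q$-commutes with $h$, and $g,h$ commute,
then $z=0$ (`TaftBasis.eq_smul_x`).

Rigidity of $x$ and $h$ is used twice. Applied to $gxg^{-1}$ it gives $ghg^{-1}=h$ and $gx=\omega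
xg$ with $\omega^n=1$, so $E\cong T^\omega$ (`TaftBasis.exists_bialgEquiv`); conversely every
$T^\omega$ factorizes, because a matrix model shows that its monomials are independent. Applied to
an isomorphism $T^\omega\to T^{\omega'}$ it gives $h\mapsto h$, $x\mapsto\alpha x$, $g\mapsto h^a
g^c$, whence $\omega'^c=\omega q^a$. Such an equation with $c$ coprime to $n$ conversely yields an
isomorphism.

What remains is arithmetic in the cyclic group $U_n(K)$: modulo the powers of $q$ it contains, which
form its subgroup of order $d$, it is cyclic of order $\nu(n)/d$, and parameters are equivalent when
their classes generate the same subgroup. Subgroups correspond to divisors of $\nu(n)/d$, which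
gives all three claims. -/

noncomputable section

/-! ### Monomials `h ^ a x ^ b g ^ c` -/

/-- Exponents `(a, b, c)` of the monomials `h ^ a x ^ b g ^ c`. -/
abbrev TaftIndex (n m : ℕ) : Type := ZMod m × Fin m × ZMod n

/-- The monomial `h ^ a x ^ b g ^ c`. -/
def taftMonomial {n m : ℕ} {R : Type v} [Ring R] (h x g : R) (s : TaftIndex n m) : R :=
  h ^ s.1.val * x ^ (s.2.1 : ℕ) * g ^ s.2.2.val

theorem pow_zmod_val_natCast {R : Type v} [Monoid R] {k : ℕ} {g : R}
    (hg : g ^ k = 1) (a : ℕ) : g ^ (a : ZMod k).val = g ^ a := by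
  rw [ZMod.val_natCast, ← pow_eq_pow_mod a hg]

theorem h_pow_mul_x {K : Type u} [Field K] {R : Type v} [Ring R] [Algebra K R] {q : K}
    {h x : R} (hxh : x * h = q • (h * x)) (k : ℕ) : x * h ^ k = q ^ k • (h ^ k * x) := by
  induction k with
  | zero => simp
  | succ k ih =>
    rw [pow_succ, ← mul_assoc, ih, smul_mul_assoc, mul_assoc, hxh, mul_smul_comm, smul_smul,
      ← mul_assoc, pow_succ]

/-- The elements $y$ with $yS\subseteq S$ form a subalgebra; containing the generators, it is
everything, and then $y=y\cdot 1\in S$. -/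
theorem mul_mem_of_adjoin {K : Type u} [Field K] {R : Type v} [Ring R] [Algebra K R]
    {s : Set R} (hs : Algebra.adjoin K s = ⊤) (S : Submodule K R) (h1 : (1 : R) ∈ S)
    (hmul : ∀ a ∈ s, ∀ b ∈ S, a * b ∈ S) : S = ⊤ := by
  rw [eq_top_iff]
  intro y _
  have hy : y ∈ Algebra.adjoin K s := hs ▸ Algebra.mem_top
  clear * - hy hmul h1
  suffices ∀ b ∈ S, y * b ∈ S by simpa using this 1 h1
  induction hy using Algebra.adjoin_induction with
  | mem a ha => exact hmul a ha
  | algebraMap r => intro b hb; rw [← Algebra.smul_def]; exact S.smul_mem r hb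
  | add a b _ _ h₁ h₂ => intro c hc; rw [add_mul]; exact S.add_mem (h₁ c hc) (h₂ c hc)
  | mul a b _ _ h₁ h₂ => intro c hc; rw [mul_assoc]; exact h₁ _ (h₂ c hc)

section span

variable {K : Type u} [Field K] {R : Type v} [Ring R] [Algebra K R] {n m : ℕ}
  {q ω : K} {h x g : R}

theorem monomial_mem_span (hg : g ^ n = 1) (hh : h ^ m = 1) (hx : x ^ m = 0) (a b c : ℕ) :
    h ^ a * x ^ b * g ^ c ∈
      Submodule.span K (Set.range (taftMonomial (n := n) (m := m) h x g)) := by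
  by_cases hb : b < m
  · refine Submodule.subset_span ⟨((a : ZMod m), ⟨b, hb⟩, (c : ZMod n)), ?_⟩
    simp only [taftMonomial, pow_zmod_val_natCast hh, pow_zmod_val_natCast hg]
  · rw [pow_eq_zero_of_le (not_lt.1 hb) hx]
    simp

/-- Left multiplication by a generator sends a monomial to a scalar multiple of a monomial: $g$
passes $h$ freely and $x^j$ at the cost of $\omega^j$, and $x$ passes $h^i$ at the cost of $q^i$.
Working in an arbitrary algebra lets the Taft algebra be covered too, with $n=1$ and $g=1$. -/
theorem span_taftMonomial (hg : g ^ n = 1) (hh : h ^ m = 1) (hx : x ^ m = 0)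
    (hxh : x * h = q • (h * x)) (hhg : h * g = g * h) (hgx : g * x = ω • (x * g))
    (hs : Algebra.adjoin K {g, h, x} = ⊤) :
    Submodule.span K (Set.range (taftMonomial (n := n) (m := m) h x g)) = ⊤ := by
  refine mul_mem_of_adjoin hs _ (by simpa using monomial_mem_span hg hh hx 0 0 0) ?_
  intro a ha b hb
  induction hb using Submodule.span_induction with
  | mem b hb =>
    obtain ⟨⟨i, j, k⟩, rfl⟩ := hb
    simp only [taftMonomial]
    rcases ha with rfl | rfl | rfl
    · have : a * (h ^ i.val * x ^ (j : ℕ) * a ^ k.val)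
          = ω ^ (j : ℕ) • (h ^ i.val * x ^ (j : ℕ) * a ^ (k.val + 1)) := by
        rw [mul_assoc, ← mul_assoc, ((show Commute h a from hhg).pow_left i.val).eq.symm,
          mul_assoc, ← mul_assoc a]
        have h1 : ∀ j : ℕ, a * x ^ j = ω ^ j • (x ^ j * a) := by
          intro j
          induction j with
          | zero => simp
          | succ j ih =>
            rw [pow_succ, ← mul_assoc, ih, smul_mul_assoc, mul_assoc, hgx, mul_smul_comm,
              smul_smul, pow_succ, mul_assoc]
        rw [h1, smul_mul_assoc, mul_smul_comm, pow_succ']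
        simp only [mul_assoc]
      rw [this]
      exact Submodule.smul_mem _ _ (monomial_mem_span hg hh hx _ _ _)
    · have := monomial_mem_span (K := K) hg hh hx (i.val + 1) j k.val
      rwa [pow_succ', mul_assoc, mul_assoc, ← mul_assoc (a ^ _)] at this
    · rw [← mul_assoc, ← mul_assoc, h_pow_mul_x hxh, smul_mul_assoc, smul_mul_assoc, mul_assoc (_ ^ _),
        ← pow_succ']
      exact Submodule.smul_mem _ _ (monomial_mem_span hg hh hx _ _ _)
  | zero => simp
  | add b c _ _ h₁ h₂ => rw [mul_add]; exact Submodule.add_mem _ h₁ h₂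
  | smul r b _ h₁ => rw [mul_smul_comm]; exact Submodule.smul_mem _ _ h₁

end span

/-! ### A faithful matrix model -/

namespace CyclicTaft

section model

variable (K : Type u) [Field K] (n m : ℕ)

/-- The group algebra of `ℤ/m × ℤ/n`, over which the matrix model is defined. -/
abbrev ModelRing : Type u := AddMonoidAlgebra K (ZMod m × ZMod n)

/-- The nilpotent shift matrix. -/
def shiftMatrix : Matrix (Fin m) (Fin m) (ModelRing K n m) :=
  Matrix.of fun i j => if (i : ℕ) + 1 = j then 1 else 0

/-- A diagonal matrix with entries `a ^ i` times a group element. -/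
def twistMatrix (a : K) (s : ZMod m × ZMod n) : Matrix (Fin m) (Fin m) (ModelRing K n m) :=
  Matrix.diagonal fun i => AddMonoidAlgebra.single s (a ^ (i : ℕ))

theorem shiftMatrix_pow (b : ℕ) : shiftMatrix K n m ^ b =
    Matrix.of fun i j : Fin m => if (i : ℕ) + b = j then (1 : ModelRing K n m) else 0 := by
  induction b with
  | zero => ext i j; simp [Matrix.one_apply, Fin.ext_iff]
  | succ b ih =>
    rw [pow_succ, ih]
    refine Matrix.ext fun i j => ?_
    simp only [Matrix.mul_apply, shiftMatrix, Matrix.of_apply, ite_mul, one_mul, zero_mul]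
    by_cases hij : (i : ℕ) + (b + 1) = j
    · rw [Finset.sum_eq_single (⟨i + b, by have := j.2; omega⟩ : Fin m)]
      · simp [hij]; omega
      · intro k _ hk
        rw [if_neg]
        intro h; exact hk (Fin.ext h.symm)
      · simp
    · rw [if_neg hij]
      refine Finset.sum_eq_zero fun k _ => ?_
      split_ifs <;> first | omega | rfl

theorem twistMatrix_pow (a : K) (s : ZMod m × ZMod n) (k : ℕ) :
    twistMatrix K n m a s ^ k = twistMatrix K n m (a ^ k) (k • s) := by
  rw [twistMatrix, Matrix.diagonal_pow, twistMatrix]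
  congr 1
  ext1 i
  simp [AddMonoidAlgebra.single_pow, ← pow_mul, mul_comm]

theorem twistMatrix_pow_eq_one {a : K} {s : ZMod m × ZMod n} {k : ℕ} (ha : a ^ k = 1)
    (hs : k • s = 0) : twistMatrix K n m a s ^ k = 1 := by
  rw [twistMatrix_pow, ha, hs, twistMatrix]
  simp only [one_pow, ← AddMonoidAlgebra.one_def]
  exact Matrix.diagonal_one

theorem twistMatrix_mul_comm (a b : K) (s t : ZMod m × ZMod n) :
    twistMatrix K n m a s * twistMatrix K n m b t
      = twistMatrix K n m b t * twistMatrix K n m a s := by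
  simp [twistMatrix, AddMonoidAlgebra.single_mul_single, mul_comm]

theorem shiftMatrix_mul_twistMatrix (a : K) (s : ZMod m × ZMod n) :
    shiftMatrix K n m * twistMatrix K n m a s
      = a • (twistMatrix K n m a s * shiftMatrix K n m) := by
  refine Matrix.ext fun i j => ?_
  rw [twistMatrix, Matrix.smul_apply, Matrix.mul_diagonal, Matrix.diagonal_mul]
  simp only [shiftMatrix, Matrix.of_apply]
  split_ifs with h
  · simp [← h, pow_succ, mul_comm]
  · simp

variable {K n m} {q ω : K} [NeZero n] [NeZero m]

/-- The matrix model of `T_{nm²}^ω(q)`. -/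
def toMatrix (hq : q ^ m = 1) (hω : ω ^ n = 1) :
    CyclicTaft K n m q ω →ₐ[K] Matrix (Fin m) (Fin m) (ModelRing K n m) :=
  -- Moving the shift to the right past a twist with parameter $a$ costs a factor $a$. The relation
  -- $xh=q\,hx$ has this orientation, while $gx=\omega\,xg$ has the opposite one, hence the inverse.
  lift (twistMatrix K n m ω⁻¹ (0, 1)) (twistMatrix K n m q (1, 0)) (shiftMatrix K n m)
    (twistMatrix_pow_eq_one K n m (by simp [hω]) (by simp))
    (twistMatrix_pow_eq_one K n m hq (by simp))
    (by
      rw [shiftMatrix_pow]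
      refine Matrix.ext fun i j => ?_
      have := j.2
      simp only [Matrix.of_apply, Matrix.zero_apply]
      rw [if_neg (by omega)])
    (shiftMatrix_mul_twistMatrix K n m q _)
    (twistMatrix_mul_comm K n m _ _ _ _)
    (by
      have hω0 : ω ≠ 0 := by
        rintro rfl
        simp [NeZero.ne n] at hω
      rw [shiftMatrix_mul_twistMatrix, smul_smul, mul_inv_cancel₀ hω0, one_smul])

/-- Row $0$ alone separates the monomials: the column records the exponent of $x$ and the group
element the exponents of $h$ and $g$. No power of $q$ appears because the diagonal entry of $h$ in
row $0$ carries $q^0$. -/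
theorem toMatrix_taftMonomial (hq : q ^ m = 1) (hω : ω ^ n = 1) (s : TaftIndex n m) (b : Fin m) :
    toMatrix hq hω (taftMonomial (h K n m q ω) (x K n m q ω) (g K n m q ω) s) 0 b =
      if s.2.1 = b then AddMonoidAlgebra.single (s.1, s.2.2) ((ω⁻¹ ^ s.2.2.val) ^ (b : ℕ))
      else 0 := by
  simp only [taftMonomial, map_mul, map_pow, toMatrix, lift_g, lift_h, lift_x, twistMatrix_pow,
    shiftMatrix_pow]
  rw [twistMatrix, twistMatrix, Matrix.mul_diagonal, Matrix.diagonal_mul]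
  by_cases h : s.2.1 = b
  · simp [h, AddMonoidAlgebra.single_mul_single]
  · have h' : ¬ ((s.2.1 : ℕ) = b) := fun e => h (Fin.ext e)
    simp [h, h']

theorem linearIndependent_taftMonomial (hq : q ^ m = 1) (hω : ω ^ n = 1) :
    LinearIndependent K
      (taftMonomial (n := n) (m := m) (h K n m q ω) (x K n m q ω) (g K n m q ω)) := by
  rw [Fintype.linearIndependent_iff]
  intro f hf s
  have hω0 : ω ≠ 0 := by
    rintro rfl
    simp [NeZero.ne n] at hω
  -- This coefficient isolates the term of index `s`, up to a power of $\omega^{-1}$, which is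
  -- nonzero.
  have h1 := congrArg (fun y => (toMatrix hq hω y 0 s.2.1).coeff (s.1, s.2.2)) hf
  simp only [map_sum, map_smul, Matrix.sum_apply, Matrix.smul_apply, toMatrix_taftMonomial,
    map_zero, Matrix.zero_apply, AddMonoidAlgebra.coeff_zero, AddMonoidAlgebra.coeff_sum,
    Finsupp.finsetSum_apply, Finsupp.coe_zero, Pi.zero_apply] at h1
  rw [Finset.sum_eq_single s] at h1
  · simpa [hω0] using h1
  · rintro ⟨i, j, k⟩ _ hne
    split_ifs with hj
    · simp only at hj
      subst hj
      rw [AddMonoidAlgebra.smul_single, AddMonoidAlgebra.coeff_single, Finsupp.single_apply, if_neg]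
      rintro h
      apply hne
      simp [Prod.ext_iff] at h ⊢
      exact h
    · simp
  · simp

/-- The monomial basis of `T_{nm²}^ω(q)`. -/
def monomialBasis (hq : q ^ m = 1) (hω : ω ^ n = 1) :
    Module.Basis (TaftIndex n m) K (CyclicTaft K n m q ω) :=
  Module.Basis.mk (linearIndependent_taftMonomial hq hω)
    (span_taftMonomial (g_pow K n m q ω) (h_pow K n m q ω) (x_pow K n m q ω) (x_mul_h K n m q ω)
      (h_mul_g K n m q ω) (g_mul_x K n m q ω) (adjoin_eq_top K n m q ω)).ge

theorem monomialBasis_apply (hq : q ^ m = 1) (hω : ω ^ n = 1) (s : TaftIndex n m) :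
    monomialBasis hq hω s = taftMonomial (h K n m q ω) (x K n m q ω) (g K n m q ω) s := by
  simp [monomialBasis]

end model

end CyclicTaft

namespace Taft

variable {K : Type u} [Field K] {m : ℕ} [NeZero m] {q : K}

omit [NeZero m] in
theorem span_monomial : Submodule.span K
    (Set.range (taftMonomial (n := 1) (m := m) (h K m q) (x K m q) 1)) = ⊤ :=
  span_taftMonomial (ω := 1) (one_pow _) (h_pow K m q) (x_pow K m q) (x_mul_h K m q)
    (by simp) (by simp) (by
      rw [eq_top_iff, ← adjoin_eq_top K m q]
      exact Algebra.adjoin_mono (by simp))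

/-- Independence is pulled back along the map to $T^{1}_{nm^2}$ with $n=1$, where the relation
$g^1=1$ makes $g$ trivial. -/
theorem linearIndependent_monomial (hq : q ^ m = 1) : LinearIndependent K
    (taftMonomial (n := 1) (m := m) (h K m q) (x K m q) 1) := by
  let f : Taft K m q →ₐ[K] CyclicTaft K 1 m q 1 :=
    lift (CyclicTaft.h K 1 m q 1) (CyclicTaft.x K 1 m q 1) (CyclicTaft.h_pow K 1 m q 1)
      (CyclicTaft.x_pow K 1 m q 1) (CyclicTaft.x_mul_h K 1 m q 1)
  refine LinearIndependent.of_comp f.toLinearMap ?_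
  convert CyclicTaft.linearIndependent_taftMonomial (n := 1) (ω := 1) hq (one_pow 1) using 1
  ext1 s
  have hg : CyclicTaft.g K 1 m q 1 = 1 := by simpa using CyclicTaft.g_pow K 1 m q 1
  simp [taftMonomial, f, hg]

end Taft

/-! ### Group-like and skew-primitive elements of a bialgebra with a monomial basis -/

/-- Group-like elements `g`, `h` and a `(1, h)`-primitive element `x` of a bialgebra with
`x h = q h x`, such that the monomials `h ^ a x ^ b g ^ c` form a basis. No commutation relation
involving `g` is assumed. -/
structure TaftBasis (K : Type u) [Field K] (E : Type v) [Ring E] [Bialgebra K E] (n m : ℕ)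
    [NeZero n] [NeZero m] (q : K) where
  /-- The group-like element of order `n`. -/
  g : E
  /-- The group-like element of order `m`. -/
  h : E
  /-- The skew-primitive element. -/
  x : E
  g_pow : g ^ n = 1
  h_pow : h ^ m = 1
  x_pow : x ^ m = 0
  x_mul_h : x * h = q • (h * x)
  isGroupLikeElem_g : IsGroupLikeElem K g
  isGroupLikeElem_h : IsGroupLikeElem K h
  counit_x : Coalgebra.counit (R := K) x = 0
  comul_x : Coalgebra.comul (R := K) x = x ⊗ₜ h + 1 ⊗ₜ x
  /-- The basis of monomials. -/
  basis : Module.Basis (TaftIndex n m) K E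
  basis_apply : ∀ s, basis s = taftMonomial h x g s

/-- The span of the group-like elements. -/
def groupLikeSpan (K : Type u) [Field K] (E : Type v) [Ring E] [Bialgebra K E] : Submodule K E :=
  Submodule.span K {u | IsGroupLikeElem K u}

section groupLikeSpan

variable {K : Type u} [Field K] {E : Type v} [Ring E] [Bialgebra K E]

theorem mul_mem_groupLikeSpan {u y : E} (hu : IsGroupLikeElem K u) (hy : y ∈ groupLikeSpan K E) :
    u * y ∈ groupLikeSpan K E := by
  induction hy using Submodule.span_induction with
  | mem y hy => exact Submodule.subset_span (hu.mul hy)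
  | zero => simp
  | add a b _ _ h₁ h₂ => rw [mul_add]; exact Submodule.add_mem _ h₁ h₂
  | smul r b _ h₁ => rw [mul_smul_comm]; exact Submodule.smul_mem _ _ h₁

theorem mem_groupLikeSpan_mul {u y : E} (hu : IsGroupLikeElem K u) (hy : y ∈ groupLikeSpan K E) :
    y * u ∈ groupLikeSpan K E := by
  induction hy using Submodule.span_induction with
  | mem y hy => exact Submodule.subset_span (IsGroupLikeElem.mul hy hu)
  | zero => simp
  | add a b _ _ h₁ h₂ => rw [add_mul]; exact Submodule.add_mem _ h₁ h₂
  | smul r b _ h₁ => rw [smul_mul_assoc]; exact Submodule.smul_mem _ _ h₁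

theorem map_mem_groupLikeSpan {F : Type v} [Ring F] [Bialgebra K F] (f : E →ₐc[K] F) {y : E}
    (hy : y ∈ groupLikeSpan K E) : f y ∈ groupLikeSpan K F := by
  induction hy using Submodule.span_induction with
  | mem y hy => exact Submodule.subset_span (IsGroupLikeElem.map f hy)
  | zero => simp
  | add a b _ _ h₁ h₂ => rw [map_add]; exact Submodule.add_mem _ h₁ h₂
  | smul r b _ h₁ => rw [map_smul]; exact Submodule.smul_mem _ _ h₁

end groupLikeSpan

namespace TaftBasis

variable {K : Type u} [Field K] {E : Type v} [Ring E] [Bialgebra K E] {n m : ℕ}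
  [NeZero n] [NeZero m] {q : K} (T : TaftBasis K E n m q)

theorem monomial_eq_basis (a c : ℕ) {b : ℕ} (hb : b < m) :
    T.h ^ a * T.x ^ b * T.g ^ c = T.basis ((a : ZMod m), ⟨b, hb⟩, (c : ZMod n)) := by
  simp only [T.basis_apply, taftMonomial, pow_zmod_val_natCast T.h_pow,
    pow_zmod_val_natCast T.g_pow]

theorem one_eq_basis : (1 : E) = T.basis 0 := by
  have := T.monomial_eq_basis 0 0 (NeZero.pos m)
  simp only [pow_zero, mul_one, Nat.cast_zero] at this
  exact this

theorem h_eq_basis : T.h = T.basis (1, 0, 0) := by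
  have := T.monomial_eq_basis 1 0 (NeZero.pos m)
  simpa using this

theorem x_eq_basis (hm : 1 < m) : T.x = T.basis (0, ⟨1, hm⟩, 0) := by
  have := T.monomial_eq_basis 0 0 hm
  simpa using this

theorem basis_zero (a : ZMod m) (c : ZMod n) :
    T.basis (a, 0, c) = T.h ^ a.val * T.g ^ c.val := by
  simp [T.basis_apply, taftMonomial]

theorem isGroupLikeElem_basis (a : ZMod m) (c : ZMod n) :
    IsGroupLikeElem K (T.basis (a, 0, c)) := by
  rw [basis_zero]
  exact T.isGroupLikeElem_h.pow.mul T.isGroupLikeElem_g.pow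

/-- The summands $x\otimes h$ and $1\otimes x$ of $\Delta(x)$ $q$-commute, so the $q$-binomial
theorem expands $\Delta(x)^b$. In $(x\otimes h)^k(1\otimes x)^{b-k}$ both legs are already in normal
order, and nothing has to move past $g$. -/
theorem comul_monomial (a b c : ℕ) : Coalgebra.comul (R := K) (T.h ^ a * T.x ^ b * T.g ^ c) =
    ∑ k ∈ Finset.range (b + 1), qBinom q b k •
      ((T.h ^ a * T.x ^ k * T.g ^ c) ⊗ₜ[K] (T.h ^ (a + k) * T.x ^ (b - k) * T.g ^ c)) := by
  have hc : (1 ⊗ₜ[K] T.x : E ⊗[K] E) * T.x ⊗ₜ T.h = q • (T.x ⊗ₜ T.h * 1 ⊗ₜ T.x) := by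
    simp [Algebra.TensorProduct.tmul_mul_tmul, T.x_mul_h]
  rw [Bialgebra.comul_mul, Bialgebra.comul_mul, Bialgebra.comul_pow, Bialgebra.comul_pow,
    Bialgebra.comul_pow, T.comul_x, T.isGroupLikeElem_g.comul_eq_tmul_self,
    T.isGroupLikeElem_h.comul_eq_tmul_self, add_pow_of_qCommute hc, Finset.mul_sum,
    Finset.sum_mul]
  refine Finset.sum_congr rfl fun k _ => ?_
  simp only [mul_smul_comm, smul_mul_assoc, Algebra.TensorProduct.tmul_pow,
    Algebra.TensorProduct.tmul_mul_tmul, one_pow, mul_one, pow_add, mul_assoc]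

/-- The coefficients of the comultiplication in the monomial basis. -/
theorem repr_comul_basis (r s t : TaftIndex n m) :
    (T.basis.tensorProduct T.basis).repr (Coalgebra.comul (R := K) (T.basis r)) (s, t) =
      if s.1 = r.1 ∧ s.2.2 = r.2.2 ∧ t.2.2 = r.2.2 ∧ t.1 = r.1 + ((s.2.1 : ℕ) : ZMod m) ∧
        (s.2.1 : ℕ) + t.2.1 = r.2.1 then qBinom q r.2.1 s.2.1 else 0 := by
  obtain ⟨a, b, c⟩ := r
  obtain ⟨a', b', c'⟩ := s
  obtain ⟨a'', b'', c''⟩ := t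
  have key : ∀ k ∈ Finset.range ((b : ℕ) + 1),
      (T.basis.tensorProduct T.basis).repr (qBinom q b k •
      ((T.h ^ a.val * T.x ^ k * T.g ^ c.val) ⊗ₜ[K]
        (T.h ^ (a.val + k) * T.x ^ ((b : ℕ) - k) * T.g ^ c.val))) ((a', b', c'), (a'', b'', c''))
      = if (b' : ℕ) = k then (if a' = a ∧ c' = c ∧ c'' = c ∧ a'' = a + ((b' : ℕ) : ZMod m) ∧
          (b' : ℕ) + b'' = b then qBinom q b b' else 0) else 0 := by
    intro k hk
    rw [Finset.mem_range] at hk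
    have h1 : k < m := by have := b.2; omega
    have h2 : (b : ℕ) - k < m := by have := b.2; omega
    rw [T.monomial_eq_basis _ _ h1, T.monomial_eq_basis _ _ h2, map_smul, Finsupp.smul_apply,
      Module.Basis.tensorProduct_repr_tmul_apply, Module.Basis.repr_self, Module.Basis.repr_self]
    simp only [Finsupp.single_apply, ZMod.natCast_val, ZMod.cast_id', id_eq, Nat.cast_add,
      Prod.mk.injEq, Fin.ext_iff]
    by_cases hb : (b' : ℕ) = k
    · subst hb
      rw [if_pos rfl]
      by_cases hh : a' = a ∧ c' = c ∧ c'' = c ∧ a'' = a + ((b' : ℕ) : ZMod m) ∧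
          (b' : ℕ) + b'' = b
      · rw [if_pos hh]
        obtain ⟨rfl, rfl, rfl, rfl, h5⟩ := hh
        have h6 : (b : ℕ) - b' = b'' := by omega
        simp [h6]
      · rw [if_neg hh]
        split_ifs with h3 h4 <;> try simp
        exfalso
        apply hh
        obtain ⟨h3, h3', h3''⟩ := h3
        obtain ⟨h4, -, h4''⟩ := h4
        exact ⟨h4.symm, h4''.symm, h3''.symm, h3.symm, by omega⟩
    · rw [if_neg hb]
      have : ¬ (k = (b' : ℕ)) := fun h => hb h.symm
      simp [this]
  rw [T.basis_apply, taftMonomial, T.comul_monomial, map_sum, Finsupp.finsetSum_apply,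
    Finset.sum_congr rfl key, Finset.sum_ite_eq]
  by_cases h1 : (b' : ℕ) ∈ Finset.range ((b : ℕ) + 1)
  · rw [if_pos h1]
  · rw [if_neg h1, if_neg]
    rintro ⟨-, -, -, -, h2⟩
    rw [Finset.mem_range] at h1
    simp only at h2
    omega

theorem repr_comul (y : E) (s t : TaftIndex n m) :
    (T.basis.tensorProduct T.basis).repr (Coalgebra.comul (R := K) y) (s, t) =
      ∑ r, T.basis.repr y r * (if s.1 = r.1 ∧ s.2.2 = r.2.2 ∧ t.2.2 = r.2.2 ∧
        t.1 = r.1 + ((s.2.1 : ℕ) : ZMod m) ∧ (s.2.1 : ℕ) + t.2.1 = r.2.1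
        then qBinom q r.2.1 s.2.1 else 0) := by
  conv_lhs => rw [← T.basis.sum_repr y]
  simp only [map_sum, map_smul, Finsupp.finsetSum_apply, Finsupp.smul_apply, repr_comul_basis,
    smul_eq_mul]

/-- Every term $h^a x^k g^c\otimes h^{a+k}x^{b-k}g^c$ of $\Delta$ has equal $g$-exponents, and
$h$-exponents differing by the $x$-exponent of the left leg, so the support constraint does not
depend on `y`. -/
theorem repr_comul_eq_zero (y : E) {s t : TaftIndex n m}
    (hst : ¬ (t.2.2 = s.2.2 ∧ t.1 = s.1 + ((s.2.1 : ℕ) : ZMod m))) :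
    (T.basis.tensorProduct T.basis).repr (Coalgebra.comul (R := K) y) (s, t) = 0 := by
  rw [repr_comul]
  refine Finset.sum_eq_zero fun r _ => ?_
  rw [if_neg, mul_zero]
  rintro ⟨h1, h2, h3, h4, -⟩
  exact hst ⟨h3.trans h2.symm, by rw [h4, h1]⟩

/-- An admissible pair of legs comes from a single monomial, so $\Delta(y)$ recovers the
coefficients of `y` up to a Gaussian binomial. -/
theorem repr_comul_of_add (y : E) (a : ZMod m) (b b' b'' : Fin m) (c : ZMod n)
    (hb : (b' : ℕ) + b'' = b) :
    (T.basis.tensorProduct T.basis).repr (Coalgebra.comul (R := K) y)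
      ((a, b', c), (a + ((b' : ℕ) : ZMod m), b'', c)) =
      T.basis.repr y (a, b, c) * qBinom q b b' := by
  rw [repr_comul, Finset.sum_eq_single (a, b, c)]
  · simp [hb]
  · rintro ⟨i, j, k⟩ _ hne
    rw [if_neg, mul_zero]
    rintro ⟨h1, h2, -, -, h5⟩
    apply hne
    simp only at h1 h2 h5
    rw [h1, h2, Fin.ext (h5.symm.trans hb)]
  · simp

/-- The group-like elements are the `h ^ a g ^ c`. -/
theorem eq_basis_of_isGroupLikeElem {u : E} (hu : IsGroupLikeElem K u) :
    ∃ a c, u = T.basis (a, 0, c) := by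
  have hcoef : ∀ s t : TaftIndex n m, ¬ (t.2.2 = s.2.2 ∧ t.1 = s.1 + ((s.2.1 : ℕ) : ZMod m)) →
      T.basis.repr u t * T.basis.repr u s = 0 := by
    intro s t hst
    have := T.repr_comul_eq_zero u hst
    rwa [hu.comul_eq_tmul_self, Module.Basis.tensorProduct_repr_tmul_apply, smul_eq_mul] at this
  -- The diagonal coefficient of $u\otimes u$ is a square, and it must vanish unless $m\mid b$, that
  -- is $b=0$ as $b<m$.
  have hpos : ∀ s : TaftIndex n m, T.basis.repr u s ≠ 0 → s.2.1 = 0 := by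
    rintro ⟨a, b, c⟩ hs
    by_contra hb
    refine hs (mul_self_eq_zero.1 (hcoef _ _ ?_))
    rintro ⟨-, h⟩
    simp only [left_eq_add, ZMod.natCast_eq_zero_iff] at h hb
    exact hb (Fin.ext (Nat.eq_zero_of_dvd_of_lt h b.2))
  obtain ⟨s, hs⟩ : ∃ s, T.basis.repr u s ≠ 0 := by
    by_contra! h
    exact hu.ne_zero (T.basis.ext_elem fun i => by rw [h i, map_zero, Finsupp.zero_apply])
  -- Two distinct indices with $x$-exponent $0$ never form an admissible pair, so only one monomial
  -- can occur; the counit then makes its coefficient $1$.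
  have hu' : u = T.basis.repr u s • T.basis s := by
    conv_lhs => rw [← T.basis.sum_repr u]
    refine Finset.sum_eq_single s (fun t _ hts => ?_) (by simp)
    by_contra ht
    have ht0 : T.basis.repr u t ≠ 0 := fun h => ht (by rw [h, zero_smul])
    have h1 := hpos s hs
    have h2 := hpos t ht0
    refine mul_ne_zero ht0 hs (hcoef s t ?_)
    rintro ⟨h3, h4⟩
    rw [h1] at h4
    exact hts (Prod.ext (by simpa using h4) (Prod.ext (h2.trans h1.symm) h3))
  obtain ⟨a, b, c⟩ := s
  have hb : b = 0 := hpos _ hs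
  subst hb
  refine ⟨a, c, ?_⟩
  have h1 := congrArg (Coalgebra.counit (R := K)) hu'
  rw [map_smul, hu.counit_eq_one, (T.isGroupLikeElem_basis a c).counit_eq_one, smul_eq_mul,
    mul_one] at h1
  rw [hu', ← h1, one_smul]

theorem groupLikeSpan_eq :
    groupLikeSpan K E = Submodule.span K (T.basis '' {s | s.2.1 = 0}) := by
  refine le_antisymm (Submodule.span_le.2 ?_) (Submodule.span_mono ?_)
  · intro u hu
    obtain ⟨a, c, rfl⟩ := T.eq_basis_of_isGroupLikeElem hu
    exact Submodule.subset_span ⟨_, rfl, rfl⟩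
  · rintro _ ⟨⟨a, b, c⟩, hb, rfl⟩
    obtain rfl : b = 0 := hb
    exact T.isGroupLikeElem_basis a c

theorem mem_groupLikeSpan_iff {y : E} :
    y ∈ groupLikeSpan K E ↔ ∀ s : TaftIndex n m, s.2.1 ≠ 0 → T.basis.repr y s = 0 := by
  rw [T.groupLikeSpan_eq, Module.Basis.mem_span_image]
  constructor
  · intro h s hs
    by_contra h1
    exact hs (h (Finsupp.mem_support_iff.2 h1))
  · intro h s hs
    by_contra h1
    exact Finsupp.mem_support_iff.1 hs (h s h1)

theorem x_notMem_groupLikeSpan (hm : 1 < m) : T.x ∉ groupLikeSpan K E := by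
  rw [T.mem_groupLikeSpan_iff]
  intro h
  have := h (0, ⟨1, hm⟩, 0) (by simp [Fin.ext_iff])
  rw [T.x_eq_basis hm] at this
  simp at this

/-- A skew-primitive element is, modulo the span of the group-like elements, a multiple
of `x`, nonzero only if it is skew-primitive with respect to `h`. -/
theorem skewPrimitive (hq : IsPrimitiveRoot q m) (hm : 1 < m) {u y : E}
    (hu : IsGroupLikeElem K u) (hy : Coalgebra.comul (R := K) y = y ⊗ₜ u + 1 ⊗ₜ y)
    (hyG : y ∉ groupLikeSpan K E) :
    u = T.h ∧ ∃ α : K, ∃ z ∈ groupLikeSpan K E, y = α • T.x + z := by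
  obtain ⟨p, l, rfl⟩ := T.eq_basis_of_isGroupLikeElem hu
  have hcoef : ∀ s t : TaftIndex n m,
      (T.basis.tensorProduct T.basis).repr (Coalgebra.comul (R := K) y) (s, t) =
      (if (p, 0, l) = t then 1 else 0) * T.basis.repr y s
        + T.basis.repr y t * (if 0 = s then 1 else 0) := by
    intro s t
    rw [hy, T.one_eq_basis, map_add, Finsupp.add_apply, Module.Basis.tensorProduct_repr_tmul_apply,
      Module.Basis.tensorProduct_repr_tmul_apply, Module.Basis.repr_self, Module.Basis.repr_self,
      Finsupp.single_apply, Finsupp.single_apply, smul_eq_mul, smul_eq_mul]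
  -- This binomial is $1+q+\dots+q^{b-1}$, which is nonzero since $q^b\ne1$ for $0<b<m$.
  have hbin : ∀ b : ℕ, b < m → 1 < b → qBinom q b 1 ≠ 0 := by
    intro b hbm hb h0
    have h1 := qInt_mul_qBinom q b 0
    have h2 : qBinom q b 0 = 1 := by cases b <;> rfl
    rw [zero_add, h0, mul_zero, h2, mul_one, Nat.sub_zero] at h1
    have h3 := mul_neg_geom_sum q b
    rw [qInt] at h1
    rw [← h1, mul_zero] at h3
    exact hq.pow_ne_one_of_pos_of_lt (by omega) hbm (sub_eq_zero.1 h3.symm).symm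
  -- Split $b=1+(b-1)$: both legs contain $x$, whereas every term of $y\otimes u+1\otimes y$ has a
  -- leg without it.
  have hlarge : ∀ (a : ZMod m) (b : Fin m) (c : ZMod n), 1 < (b : ℕ) → T.basis.repr y (a, b, c) = 0 := by
    intro a b c hb
    have hbm := b.2
    have h1 := T.repr_comul_of_add y a b ⟨1, hm⟩ ⟨b - 1, by omega⟩ c (by simp; omega)
    rw [hcoef, if_neg, if_neg, zero_mul, mul_zero, add_zero] at h1
    · exact (mul_eq_zero.1 h1.symm).resolve_right (hbin b hbm hb)
    · intro h
      have := congrArg (fun s : TaftIndex n m => (s.2.1 : ℕ)) h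
      simp at this
    · intro h
      have := congrArg (fun s : TaftIndex n m => (s.2.1 : ℕ)) h
      simp at this
      omega
  -- The splitting $1=0+1$ must come from $1\otimes y$, so its left leg $h^a g^c$ is $1$. The
  -- splitting $1=1+0$ must come from $y\otimes u$, so its right leg $h^{a+1}g^c$ is $u$.
  have hone : ∀ a c, T.basis.repr y (a, ⟨1, hm⟩, c) ≠ 0 → a = 0 ∧ c = 0 ∧ p = 1 ∧ l = 0 := by
    intro a c hne
    have h1 := T.repr_comul_of_add y a ⟨1, hm⟩ 0 ⟨1, hm⟩ c (by simp)
    have h2 := T.repr_comul_of_add y a ⟨1, hm⟩ ⟨1, hm⟩ 0 c (by simp)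
    have e1 : qBinom q 1 0 = 1 := rfl
    rw [hcoef] at h1 h2
    simp [Fin.ext_iff, Prod.ext_iff, e1, qBinom_self] at h1 h2
    have h3 := Ne.symm hne
    have h4 : 0 = a ∧ 0 = c := by tauto
    obtain ⟨rfl, rfl⟩ := h4
    simp at h2
    tauto
  obtain ⟨⟨a, b, c⟩, hb0, hne⟩ : ∃ s : TaftIndex n m, s.2.1 ≠ 0 ∧ T.basis.repr y s ≠ 0 := by
    rw [T.mem_groupLikeSpan_iff] at hyG
    push Not at hyG
    exact hyG
  have hb1 : b = ⟨1, hm⟩ := by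
    have h1 : ¬ (1 < (b : ℕ)) := fun h => hne (hlarge a b c h)
    have h2 : (b : ℕ) ≠ 0 := fun h => hb0 (Fin.ext h)
    exact Fin.ext (show (b : ℕ) = 1 by omega)
  subst hb1
  obtain ⟨rfl, rfl, rfl, rfl⟩ := hone a c hne
  refine ⟨T.h_eq_basis.symm, T.basis.repr y (0, ⟨1, hm⟩, 0),
    y - T.basis.repr y (0, ⟨1, hm⟩, 0) • T.x, ?_, by simp⟩
  rw [T.mem_groupLikeSpan_iff]
  rintro ⟨a, b, c⟩ hb
  rw [T.x_eq_basis hm, map_sub, map_smul, Finsupp.sub_apply, Finsupp.smul_apply,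
    Module.Basis.repr_self, Finsupp.single_apply]
  split_ifs with h
  · rw [← h]; simp
  · rw [smul_zero, sub_zero]
    by_contra hne
    have h1 : ¬ (1 < (b : ℕ)) := fun h => hne (hlarge a b c h)
    have h2 : (b : ℕ) ≠ 0 := fun h => hb (Fin.ext h)
    have hb1 : b = ⟨1, hm⟩ := Fin.ext (show (b : ℕ) = 1 by omega)
    subst hb1
    obtain ⟨rfl, rfl, -⟩ := hone a c hne
    exact h rfl

/-- If `g` and `h` commute, a skew-primitive element that `q`-commutes with `h` and is not in the
span of the group-like elements is a multiple of `x`. -/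
theorem eq_smul_x (hq : IsPrimitiveRoot q m) (hm : 1 < m) (hhg : Commute T.h T.g) {u y : E}
    (hu : IsGroupLikeElem K u) (hy : Coalgebra.comul (R := K) y = y ⊗ₜ u + 1 ⊗ₜ y)
    (hyG : y ∉ groupLikeSpan K E) (hyh : y * T.h = q • (T.h * y)) : ∃ α : K, y = α • T.x := by
  obtain ⟨-, α, z, hz, rfl⟩ := T.skewPrimitive hq hm hu hy hyG
  have hcomm : Commute T.h z := by
    clear * - hz hhg
    rw [T.groupLikeSpan_eq] at hz
    induction hz using Submodule.span_induction with
    | mem _ h =>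
      obtain ⟨⟨a, b, c⟩, hb, rfl⟩ := h
      obtain rfl : b = 0 := hb
      rw [T.basis_zero]
      exact ((Commute.refl _).pow_right _).mul_right (hhg.pow_right _)
    | zero => exact Commute.zero_right _
    | add a b _ _ h₁ h₂ => exact h₁.add_right h₂
    | smul r b _ h₁ => exact h₁.smul_right r
  refine ⟨α, ?_⟩
  -- The part $\alpha x$ already $q$-commutes with $h$, so $z$ must as well; as $z$ also commutes
  -- with $h$, this leaves $(1-q)hz=0$ with $q\ne1$ and $h$ invertible.
  rw [add_mul, smul_mul_assoc, T.x_mul_h, mul_add, smul_add, mul_smul_comm, smul_comm,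
    add_right_inj, ← hcomm.eq] at hyh
  have h1 : (1 - q) • (T.h * z) = 0 := by rw [sub_smul, one_smul, ← hyh, sub_self]
  have hq1 : 1 - q ≠ 0 := sub_ne_zero.2 (hq.ne_one hm).symm
  have h2 : T.h * z = 0 := (smul_eq_zero.1 h1).resolve_left hq1
  have h3 : z = 0 := by
    calc z = T.h ^ (m - 1) * (T.h * z) := by rw [← mul_assoc, pow_pred_mul_self T.h_pow, one_mul]
      _ = 0 := by rw [h2, mul_zero]
  rw [h3, add_zero]

end TaftBasis

/-! ### Bialgebra maps out of `T_{nm²}^ω(q)`, `T_{m²}(q)` and `K[C_n]` -/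

/-- Pairing the monomials of the Taft algebra with the elements of `C_n`. -/
def taftIndexEquiv (n m : ℕ) :
    TaftIndex 1 m × Multiplicative (ZMod n) ≃ TaftIndex n m where
  toFun s := (s.1.1, s.1.2.1, s.2.toAdd)
  invFun s := ((s.1, s.2.1, 0), Multiplicative.ofAdd s.2.2)
  left_inv := by rintro ⟨⟨a, b, c⟩, d⟩; simp [Subsingleton.elim c 0]
  right_inv := by rintro ⟨a, b, c⟩; rfl

theorem bijective_of_basis_map {K V W ι κ : Type*} [Field K] [AddCommGroup V] [Module K V]
    [AddCommGroup W] [Module K W] (b : Module.Basis ι K V) (c : Module.Basis κ K W) (e : ι ≃ κ)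
    (f : V →ₗ[K] W) (hf : ∀ i, f (b i) = c (e i)) : Function.Bijective f := by
  have : f = (b.equiv c e : V →ₗ[K] W) := b.ext fun i => by simp [hf]
  rw [this]
  exact (b.equiv c e).bijective

/-- The map from `K[C_n]` given by a group-like element `g` with `g ^ n = 1`. -/
def cyclicGroupAlgebraLift {K : Type u} [Field K] {n : ℕ} [NeZero n] {E : Type v} [Ring E]
    [Bialgebra K E] (g : E) (hg : g ^ n = 1) (hgl : IsGroupLikeElem K g) :
    CyclicGroupAlgebra K n →ₐc[K] E :=
  BialgHom.ofAlgHom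
    (MonoidAlgebra.lift K E (Multiplicative (ZMod n))
      { toFun := fun a => g ^ a.toAdd.val
        map_one' := by simp
        map_mul' := fun a b => by
          rw [← pow_add, ← pow_zmod_val_natCast hg (_ + _)]
          simp })
    (by
      ext a
      simp [hgl.counit_eq_one])
    (by
      ext a
      simp [hgl.comul_eq_tmul_self])

theorem cyclicGroupAlgebraLift_single {K : Type u} [Field K] {n : ℕ} [NeZero n] {E : Type v}
    [Ring E] [Bialgebra K E] (g : E) (hg : g ^ n = 1) (hgl : IsGroupLikeElem K g)
    (a : Multiplicative (ZMod n)) :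
    cyclicGroupAlgebraLift (K := K) g hg hgl (MonoidAlgebra.single a 1) = g ^ a.toAdd.val := by
  simp [cyclicGroupAlgebraLift]

namespace Taft

variable {K : Type u} [Field K] {m : ℕ} [NeZero m] {q : K} [hq : Fact (IsPrimitiveRoot q m)]

theorem isGroupLikeElem_h : IsGroupLikeElem K (h K m q) := ⟨counit_h, comul_h⟩

variable (K m q) in
/-- The monomial basis of the Taft algebra. -/
def monomialBasis : Module.Basis (TaftIndex 1 m) K (Taft K m q) :=
  Module.Basis.mk (linearIndependent_monomial hq.out.pow_eq_one) span_monomial.ge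

theorem monomialBasis_apply (s : TaftIndex 1 m) :
    monomialBasis K m q s = h K m q ^ s.1.val * x K m q ^ (s.2.1 : ℕ) := by
  simp [monomialBasis, taftMonomial]

/-- The basis of `T_{m²}(q) ⊗ K[C_n]`. -/
def tensorBasis (n : ℕ) : Module.Basis (TaftIndex 1 m × Multiplicative (ZMod n)) K
    (Taft K m q ⊗[K] CyclicGroupAlgebra K n) :=
  (monomialBasis K m q).tensorProduct (MonoidAlgebra.basis _ _)

theorem tensorBasis_apply (n : ℕ) (s : TaftIndex 1 m × Multiplicative (ZMod n)) :
    tensorBasis (K := K) (q := q) n s =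
      (h K m q ^ s.1.1.val * x K m q ^ (s.1.2.1 : ℕ)) ⊗ₜ MonoidAlgebra.single s.2 1 := by
  rw [tensorBasis, Module.Basis.tensorProduct_apply', monomialBasis_apply]
  simp

end Taft

namespace CyclicTaft

variable {K : Type u} [Field K] {n m : ℕ} [NeZero m] {q ω : K}
  [hq : Fact (IsPrimitiveRoot q m)]

theorem isGroupLikeElem_g : IsGroupLikeElem K (g K n m q ω) := ⟨counit_g, comul_g⟩

theorem isGroupLikeElem_h : IsGroupLikeElem K (h K n m q ω) := ⟨counit_h, comul_h⟩

/-- The universal property for bialgebra maps. -/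
def liftBialgHom {B : Type v} [Ring B] [Bialgebra K B] (c b y : B) (g_pow : c ^ n = 1)
    (h_pow : b ^ m = 1) (x_pow : y ^ m = 0) (x_mul_h : y * b = q • (b * y))
    (h_mul_g : b * c = c * b) (g_mul_x : c * y = ω • (y * c)) (hc : IsGroupLikeElem K c)
    (hb : IsGroupLikeElem K b) (counit_y : Coalgebra.counit (R := K) y = 0)
    (comul_y : Coalgebra.comul (R := K) y = y ⊗ₜ b + 1 ⊗ₜ y) : CyclicTaft K n m q ω →ₐc[K] B :=
  BialgHom.ofAlgHom (lift c b y g_pow h_pow x_pow x_mul_h h_mul_g g_mul_x)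
    (algHom_ext (by simp [hc]) (by simp [hb]) (by simp [counit_y]))
    (algHom_ext (by simp [hc]) (by simp [hb]) (by simp [comul_y]))

variable [NeZero n]

/-- The Taft algebra inside `T_{nm²}^ω(q)`. -/
def ofTaft : Taft K m q →ₐc[K] CyclicTaft K n m q ω :=
  BialgHom.ofAlgHom
    (Taft.lift (h K n m q ω) (x K n m q ω) (h_pow K n m q ω) (x_pow K n m q ω) (x_mul_h K n m q ω))
    (Taft.algHom_ext (by simp) (by simp)) (Taft.algHom_ext (by simp) (by simp))

/-- The monomial basis of `T_{nm²}^ω(q)` together with its generators. -/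
def taftBasis (hω : ω ^ n = 1) : TaftBasis K (CyclicTaft K n m q ω) n m q where
  g := g K n m q ω
  h := h K n m q ω
  x := x K n m q ω
  g_pow := g_pow K n m q ω
  h_pow := h_pow K n m q ω
  x_pow := x_pow K n m q ω
  x_mul_h := x_mul_h K n m q ω
  isGroupLikeElem_g := isGroupLikeElem_g
  isGroupLikeElem_h := isGroupLikeElem_h
  counit_x := counit_x
  comul_x := comul_x
  basis := monomialBasis hq.out.pow_eq_one hω
  basis_apply := monomialBasis_apply hq.out.pow_eq_one hω

/-- Multiplication carries the tensor product basis to the monomial basis, so it is bijective.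
Injectivity of the two inclusions follows by restricting it to $a\otimes1$ and $1\otimes b$. -/
theorem factorizesThrough (hω : ω ^ n = 1) :
    FactorizesThrough K (Taft K m q) (CyclicGroupAlgebra K n) (CyclicTaft K n m q ω) := by
  let j := cyclicGroupAlgebraLift (K := K) (g K n m q ω) (g_pow K n m q ω) isGroupLikeElem_g
  have hb : Function.Bijective (LinearMap.mul' K (CyclicTaft K n m q ω) ∘ₗ
      TensorProduct.map ((ofTaft : Taft K m q →ₐc[K] CyclicTaft K n m q ω) :
        Taft K m q →ₐ[K] CyclicTaft K n m q ω).toLinearMap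
        (j : CyclicGroupAlgebra K n →ₐ[K] CyclicTaft K n m q ω).toLinearMap) := by
    refine bijective_of_basis_map (Taft.tensorBasis n) (monomialBasis hq.out.pow_eq_one hω)
      (taftIndexEquiv n m) _ ?_
    rintro ⟨⟨a, b, c⟩, l⟩
    have h1 : j (MonoidAlgebra.single l 1) = _ :=
      cyclicGroupAlgebraLift_single (K := K) (g K n m q ω) (g_pow K n m q ω) isGroupLikeElem_g l
    rw [Taft.tensorBasis_apply, monomialBasis_apply]
    simp [h1, taftIndexEquiv, taftMonomial, ofTaft]
  have : Nontrivial (Taft K m q) :=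
    (Bialgebra.counitAlgHom K (Taft K m q)).toRingHom.domain_nontrivial
  refine ⟨ofTaft, j, ?_, ?_, hb⟩
  · intro a b hab
    refine Algebra.TensorProduct.includeLeft_injective (R := K) (S := K) (A := Taft K m q)
      (B := CyclicGroupAlgebra K n) (algebraMap K _).injective (hb.1 ?_)
    simp [hab]
  · intro a b hab
    refine Algebra.TensorProduct.includeRight_injective (R := K) (A := Taft K m q)
      (B := CyclicGroupAlgebra K n) (algebraMap K (Taft K m q)).injective (hb.1 ?_)
    simp [hab]

end CyclicTaft

/-! ### Classification of the Hopf algebras that factorize -/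

/-- A Hopf algebra that factorizes through `T_{m²}(q)` and `K[C_n]` has a monomial basis. -/
theorem FactorizesThrough.exists_taftBasis {K : Type u} [Field K] {n m : ℕ} [NeZero n] [NeZero m]
    {q : K} [hq : Fact (IsPrimitiveRoot q m)] {E : Type v} [Ring E] [HopfAlgebra K E]
    (hE : FactorizesThrough K (Taft K m q) (CyclicGroupAlgebra K n) E) :
    Nonempty (TaftBasis K E n m q) := by
  obtain ⟨i, j, -, -, hb⟩ := hE
  let γ : CyclicGroupAlgebra K n := MonoidAlgebra.of K _ (Multiplicative.ofAdd 1)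
  have hγ : ∀ l : Multiplicative (ZMod n), γ ^ l.toAdd.val = MonoidAlgebra.single l 1 := by
    intro l
    rw [← map_pow, ← ofAdd_nsmul]
    simp
  have hγn : γ ^ n = 1 := by
    rw [← map_pow, ← ofAdd_nsmul]
    simp [MonoidAlgebra.one_def]
  have hγl : IsGroupLikeElem K γ := MonoidAlgebra.isGroupLikeElem_of _
  refine ⟨{
    g := j γ
    h := i (Taft.h K m q)
    x := i (Taft.x K m q)
    g_pow := by rw [← map_pow, hγn, map_one]
    h_pow := by rw [← map_pow, Taft.h_pow, map_one]
    x_pow := by rw [← map_pow, Taft.x_pow, map_zero]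
    x_mul_h := by rw [← map_mul, Taft.x_mul_h, map_smul, map_mul]
    isGroupLikeElem_g := hγl.map j
    isGroupLikeElem_h := Taft.isGroupLikeElem_h.map i
    counit_x := by rw [CoalgHomClass.counit_comp_apply, Taft.counit_x]
    comul_x := by
      rw [← CoalgHomClass.map_comp_comul_apply, Taft.comul_x]
      simp
    basis := ((Taft.tensorBasis n).map (LinearEquiv.ofBijective _ hb)).reindex
      (taftIndexEquiv n m)
    basis_apply := ?_ }⟩
  rintro ⟨a, b, c⟩
  have hγc : γ ^ c.val = MonoidAlgebra.single (Multiplicative.ofAdd c) 1 := hγ (.ofAdd c)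
  simp [Taft.tensorBasis_apply, taftIndexEquiv, taftMonomial, ← map_pow, hγc]

namespace TaftBasis

variable {K : Type u} [Field K] {E : Type v} [Ring E] [Bialgebra K E] {n m : ℕ}
  [NeZero n] [NeZero m] {q : K} (T : TaftBasis K E n m q)

include T in
/-- A bialgebra with a monomial basis is one of the `T_{nm²}^ω(q)`. -/
theorem exists_bialgEquiv [hq : Fact (IsPrimitiveRoot q m)] (hm : 1 < m) :
    ∃ ω : K, ω ^ n = 1 ∧ Nonempty (CyclicTaft K n m q ω ≃ₐc[K] E) := by
  have hinv := pow_pred_mul_self T.g_pow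
  have hinv' := self_mul_pow_pred T.g_pow
  have hgg : IsGroupLikeElem K (T.g ^ (n - 1)) := T.isGroupLikeElem_g.pow
  set γ := T.g ^ (n - 1) with hγ
  have hx : γ * (T.g * T.x * γ) * T.g = T.x := by
    rw [← mul_assoc, ← mul_assoc, hinv, one_mul, mul_assoc, hinv, mul_one]
  -- Here $\gamma=g^{-1}$; the span of the group-likes is stable under conjugation by $g$, and $x$
  -- lies outside it.
  have hyG : T.g * T.x * γ ∉ groupLikeSpan K E := by
    intro h
    refine T.x_notMem_groupLikeSpan hm ?_
    rw [← hx]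
    exact mem_groupLikeSpan_mul T.isGroupLikeElem_g (mul_mem_groupLikeSpan hgg h)
  have hu : IsGroupLikeElem K (T.g * T.h * γ) :=
    (T.isGroupLikeElem_g.mul T.isGroupLikeElem_h).mul hgg
  have hy : Coalgebra.comul (R := K) (T.g * T.x * γ)
      = (T.g * T.x * γ) ⊗ₜ (T.g * T.h * γ) + 1 ⊗ₜ (T.g * T.x * γ) := by
    rw [Bialgebra.comul_mul, Bialgebra.comul_mul, T.comul_x, hgg.comul_eq_tmul_self,
      T.isGroupLikeElem_g.comul_eq_tmul_self]
    simp [mul_add, add_mul, Algebra.TensorProduct.tmul_mul_tmul, hinv']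
  -- The conjugate $gxg^{-1}$ is skew-primitive with respect to $ghg^{-1}$, and $h$ is the only
  -- group-like allowing this outside the group-like span. Commutation of $g$ and $h$ is thus
  -- derived, not assumed.
  have hgh : T.g * T.h * γ = T.h := (T.skewPrimitive hq.out hm hu hy hyG).1
  have hhg : T.h * T.g = T.g * T.h := by
    conv_lhs => rw [← hgh]
    rw [mul_assoc, hinv, mul_one]
  have hhγ : γ * T.h = T.h * γ :=
    ((show Commute T.g T.h from hhg.symm).pow_left _).eq
  obtain ⟨ω, hω⟩ := T.eq_smul_x hq.out hm hhg hu hy hyG (by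
    rw [mul_assoc, hhγ, ← mul_assoc, mul_assoc T.g, T.x_mul_h]
    simp only [mul_smul_comm, smul_mul_assoc, ← mul_assoc, hhg])
  have hgx : T.g * T.x = ω • (T.x * T.g) := by
    rw [← smul_mul_assoc, ← hω, mul_assoc, hinv, mul_one]
  have hpow : ∀ k : ℕ, T.g ^ k * T.x = ω ^ k • (T.x * T.g ^ k) := by
    intro k
    induction k with
    | zero => simp
    | succ k ih =>
      rw [pow_succ, mul_assoc, hgx, mul_smul_comm, ← mul_assoc, ih, smul_mul_assoc, smul_smul,
        mul_assoc, pow_succ, mul_comm]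
  have hωn : ω ^ n = 1 := by
    have h1 := hpow n
    rw [T.g_pow, one_mul, mul_one] at h1
    have h2 : (ω ^ n - 1) • T.x = 0 := by rw [sub_smul, one_smul, ← h1, sub_self]
    refine sub_eq_zero.1 ((smul_eq_zero.1 h2).resolve_right ?_)
    intro h0
    exact T.x_notMem_groupLikeSpan hm (h0 ▸ Submodule.zero_mem _)
  let f : CyclicTaft K n m q ω →ₐc[K] E :=
    CyclicTaft.liftBialgHom T.g T.h T.x T.g_pow T.h_pow T.x_pow T.x_mul_h hhg hgx
      T.isGroupLikeElem_g T.isGroupLikeElem_h T.counit_x T.comul_x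
  refine ⟨ω, hωn, ⟨BialgEquiv.ofBijective f ?_⟩⟩
  refine bijective_of_basis_map (CyclicTaft.taftBasis hωn).basis T.basis (Equiv.refl _)
    (f : CyclicTaft K n m q ω →ₗ[K] E) fun s => ?_
  rw [T.basis_apply, TaftBasis.basis_apply]
  simp [taftMonomial, f, CyclicTaft.liftBialgHom, CyclicTaft.taftBasis]

end TaftBasis

/-! ### Isomorphisms between the `T_{nm²}^ω(q)` -/

namespace CyclicTaft

variable {K : Type u} [Field K] {n m : ℕ} [NeZero m] {q ω ω' : K}

omit [NeZero m] in
theorem gPow_mul_x (c : ℕ) :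
    g K n m q ω ^ c * x K n m q ω = ω ^ c • (x K n m q ω * g K n m q ω ^ c) :=
  pow_mul_of_qCommute (g_mul_x K n m q ω) c

-- The power of $q$ stays on the left to avoid inverses: $h^a g^c$ passes $x$ with factor
-- $q^{-a}\omega^c$.
omit [NeZero m] in
theorem monomial_mul_x (a c : ℕ) :
    q ^ a • (h K n m q ω ^ a * g K n m q ω ^ c * x K n m q ω) =
      ω ^ c • (x K n m q ω * (h K n m q ω ^ a * g K n m q ω ^ c)) := by
  rw [mul_assoc, gPow_mul_x, ← mul_assoc (x K n m q ω), h_pow_mul_x (x_mul_h K n m q ω)]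
  simp only [mul_smul_comm, smul_mul_assoc, mul_assoc]
  rw [smul_comm]

variable [hq : Fact (IsPrimitiveRoot q m)] [NeZero n]

/-- An isomorphism preserves the group-like span, so it fixes $h$, scales $x$ and sends $g$ to some
$h^a g^c$; the image of $gx=\omega xg$ is then an equation between scalars. -/
theorem exists_pow_eq_of_bialgEquiv (hm : 1 < m) (hω : ω ^ n = 1) (hω' : ω' ^ n = 1)
    (e : CyclicTaft K n m q ω ≃ₐc[K] CyclicTaft K n m q ω') :
    ∃ a c : ℕ, ω' ^ c = ω * q ^ a := by
  let T := taftBasis (q := q) (m := m) hω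
  let T' := taftBasis (q := q) (m := m) hω'
  have hyG : e T.x ∉ groupLikeSpan K (CyclicTaft K n m q ω') := by
    intro h
    refine T.x_notMem_groupLikeSpan hm ?_
    simpa using map_mem_groupLikeSpan (e.symm : CyclicTaft K n m q ω' →ₐc[K] CyclicTaft K n m q ω) h
  have hu : IsGroupLikeElem K (e T.h) := T.isGroupLikeElem_h.map e
  have hy : Coalgebra.comul (R := K) (e T.x) = e T.x ⊗ₜ e T.h + 1 ⊗ₜ e T.x := by
    rw [← CoalgHomClass.map_comp_comul_apply, T.comul_x]
    simp
  have hh : e T.h = T'.h := (T'.skewPrimitive hq.out hm hu hy hyG).1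
  obtain ⟨α, hα⟩ := T'.eq_smul_x hq.out hm (h_mul_g K n m q ω') hu hy hyG (by
    rw [← hh, ← map_mul, T.x_mul_h, map_smul, map_mul])
  obtain ⟨a, c, hac⟩ := T'.eq_basis_of_isGroupLikeElem (T.isGroupLikeElem_g.map e)
  rw [T'.basis_zero] at hac
  have hα0 : α ≠ 0 := by
    rintro rfl
    rw [hα, zero_smul] at hyG
    exact hyG (Submodule.zero_mem _)
  have h1 : e T.g * e T.x = ω • (e T.x * e T.g) := by
    rw [← map_mul, ← map_mul, ← map_smul]
    exact congrArg e (g_mul_x K n m q ω)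
  rw [hα, mul_smul_comm, smul_mul_assoc, smul_comm ω] at h1
  have h2 := smul_right_injective _ hα0 h1
  simp only [hac] at h2
  have h3 : q ^ a.val • (T'.h ^ a.val * T'.g ^ c.val * T'.x)
    = ω' ^ c.val • (T'.x * (T'.h ^ a.val * T'.g ^ c.val)) := monomial_mul_x _ _
  rw [h2, smul_smul] at h3
  refine ⟨a.val, c.val, ?_⟩
  by_contra hne
  have h4 : (q ^ a.val * ω - ω' ^ c.val) • (T'.x * (T'.h ^ a.val * T'.g ^ c.val)) = 0 := by
    rw [sub_smul, h3, sub_self]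
  have h5 := (smul_eq_zero.1 h4).resolve_left fun h => hne (by linear_combination -h)
  rw [← hac] at h5
  -- Were the scalars different, cancelling the invertible image of $g$ would give $x=0$.
  have h6 : T'.x * (e T.g * e T.g ^ (n - 1)) = 0 := by rw [← mul_assoc, h5, zero_mul]
  rw [← map_pow, ← map_mul, self_mul_pow_pred T.g_pow, map_one, mul_one] at h6
  exact T'.x_notMem_groupLikeSpan hm (h6 ▸ Submodule.zero_mem _)

/-- The isomorphism is $g\mapsto h^a g^c$, $h\mapsto h$, $x\mapsto x$. Coprimality of $c$ and $n$
recovers $g$ from $g^c$, hence surjectivity; equal finite dimensions give injectivity. -/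
theorem nonempty_bialgEquiv (hω : ω ^ n = 1) (hω' : ω' ^ n = 1) {a c : ℕ}
    (hc : Nat.Coprime c n) (hac : ω' ^ c = ω * q ^ a) :
    Nonempty (CyclicTaft K n m q ω ≃ₐc[K] CyclicTaft K n m q ω') := by
  -- As a ratio of $n$-th roots of unity, $q^a$ is one too; hence $m\mid an$, which is what $(h^a
  -- g^c)^n=1$ requires.
  have hqa : (q ^ a) ^ n = 1 := by
    calc (q ^ a) ^ n = (ω * q ^ a) ^ n := by rw [mul_pow, hω, one_mul]
      _ = 1 := by rw [← hac, ← pow_mul, mul_comm, pow_mul, hω', one_pow]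
  have hq0 : q ^ a ≠ 0 := pow_ne_zero _ (hq.out.ne_zero (NeZero.ne m))
  have hcomm : Commute (h K n m q ω') (g K n m q ω') := h_mul_g K n m q ω'
  let f : CyclicTaft K n m q ω →ₐc[K] CyclicTaft K n m q ω' :=
    liftBialgHom (h K n m q ω' ^ a * g K n m q ω' ^ c) (h K n m q ω') (x K n m q ω')
      (by
        rw [(hcomm.pow_pow a c).mul_pow, ← pow_mul, ← pow_mul, mul_comm c, pow_mul (g K n m q ω'),
          g_pow, one_pow, mul_one]
        rw [← pow_mul] at hqa
        obtain ⟨k, hk⟩ := (hq.out.pow_eq_one_iff_dvd _).1 hqa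
        rw [hk, pow_mul, h_pow, one_pow])
      (h_pow K n m q ω') (x_pow K n m q ω') (x_mul_h K n m q ω')
      (((Commute.refl _).pow_right _).mul_right (hcomm.pow_right _)).eq
      (by
        refine smul_right_injective _ hq0 ?_
        change q ^ a • _ = q ^ a • _
        rw [monomial_mul_x, hac, smul_smul, mul_comm])
      (isGroupLikeElem_h.pow.mul isGroupLikeElem_g.pow) isGroupLikeElem_h counit_x comul_x
  have hfg : f (g K n m q ω) = h K n m q ω' ^ a * g K n m q ω' ^ c := lift_g _ _ _ _ _ _
  have hfh : f (h K n m q ω) = h K n m q ω' := lift_h _ _ _ _ _ _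
  have hfx : f (x K n m q ω) = x K n m q ω' := lift_x _ _ _ _ _ _
  have hsurj : Function.Surjective f := by
    have hr : (f : CyclicTaft K n m q ω →ₐ[K] CyclicTaft K n m q ω').range = ⊤ := by
      rw [eq_top_iff, ← adjoin_eq_top K n m q ω', Algebra.adjoin_le_iff]
      have hh : h K n m q ω' ∈ (f : CyclicTaft K n m q ω →ₐ[K] CyclicTaft K n m q ω').range :=
        ⟨_, hfh⟩
      rintro _ (rfl | rfl | rfl)
      · have h1 : g K n m q ω' ^ c ∈
            (f : CyclicTaft K n m q ω →ₐ[K] CyclicTaft K n m q ω').range := by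
          have h2 : g K n m q ω' ^ c = (h K n m q ω' ^ (m - 1)) ^ a *
              (h K n m q ω' ^ a * g K n m q ω' ^ c) := by
            rw [← mul_assoc, ← (((Commute.refl _).pow_left _).mul_pow a),
              pow_pred_mul_self (h_pow K n m q ω'), one_pow, one_mul]
          rw [h2]
          exact mul_mem (pow_mem (pow_mem hh _) _) ⟨_, hfg⟩
        obtain ⟨k, hk⟩ := Nat.exists_mul_mod_eq_of_coprime 1 hc (NeZero.ne n)
        have h3 : g K n m q ω' = (g K n m q ω' ^ c) ^ k := by
          rw [← pow_mul, pow_eq_pow_mod (c * k) (g_pow K n m q ω'), hk.2,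
            ← pow_eq_pow_mod 1 (g_pow K n m q ω'), pow_one]
        rw [h3]
        exact pow_mem h1 _
      · exact hh
      · exact ⟨_, hfx⟩
    exact (AlgHom.range_eq_top _).1 hr
  let b := (taftBasis (q := q) (m := m) hω).basis
  let b' := (taftBasis (q := q) (m := m) hω').basis
  have := Module.Finite.of_basis b
  have := Module.Finite.of_basis b'
  have hinj : Function.Injective f :=
    (LinearMap.injective_iff_surjective_of_finrank_eq_finrank
      (f := (f : CyclicTaft K n m q ω →ₗ[K] CyclicTaft K n m q ω'))
      (by rw [Module.finrank_eq_card_basis b, Module.finrank_eq_card_basis b'])).2 hsurj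
  exact ⟨BialgEquiv.ofBijective f ⟨hinj, hsurj⟩⟩

end CyclicTaft

/-! ### Arithmetic of the parameter -/

/-- After division by $\gcd(t,N)$, $t$ becomes a unit modulo $N/\gcd(t,N)$. Unit groups surject
along $\mathbb Z/n\to\mathbb Z/k$ for $k\mid n$, so $c$ can be chosen coprime to $n$ itself. -/
theorem exists_coprime_mul_gcd_modEq {N n : ℕ} [NeZero n] (hN : N ∣ n) (t : ℕ) :
    ∃ c : ℕ, c.Coprime n ∧ Nat.gcd t N * c ≡ t [MOD N] := by
  have hN0 : 0 < N := Nat.pos_of_dvd_of_pos hN (NeZero.pos n)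
  have he : 0 < Nat.gcd t N := Nat.gcd_pos_of_pos_right _ hN0
  have hcop : Nat.Coprime (t / Nat.gcd t N) (N / Nat.gcd t N) := Nat.coprime_div_gcd_div_gcd he
  have hdvd : N / Nat.gcd t N ∣ n := (Nat.div_dvd_of_dvd (Nat.gcd_dvd_right t N)).trans hN
  obtain ⟨w, hw⟩ := ZMod.unitsMap_surjective hdvd (ZMod.unitOfCoprime _ hcop)
  refine ⟨(w : ZMod n).val, ZMod.val_coe_unit_coprime w, ?_⟩
  have h1 : ((w : ZMod n).val : ZMod (N / Nat.gcd t N)) = ((t / Nat.gcd t N : ℕ) : ZMod _) := by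
    have := congrArg Units.val hw
    rw [ZMod.unitsMap_val, ZMod.coe_unitOfCoprime] at this
    rw [← this, ZMod.natCast_val]
  have h2 := ((ZMod.natCast_eq_natCast_iff _ _ _).1 h1).mul_left' (Nat.gcd t N)
  rwa [Nat.mul_div_cancel' (Nat.gcd_dvd_right t N), Nat.mul_div_cancel' (Nat.gcd_dvd_left t N)]
    at h2

theorem IsPrimitiveRoot.pow_eq_pow_iff {K : Type u} [Field K] {z : K} {ν : ℕ}
    (hz : IsPrimitiveRoot z ν) (hν : 0 < ν) {a b : ℕ} : z ^ a = z ^ b ↔ a ≡ b [MOD ν] := by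
  rw [pow_eq_pow_mod a hz.pow_eq_one, pow_eq_pow_mod b hz.pow_eq_one]
  exact ⟨fun h => hz.pow_inj (Nat.mod_lt _ hν) (Nat.mod_lt _ hν) h, fun h => congrArg (z ^ ·) h⟩

namespace CyclicTaft

variable {K : Type u} [Field K] {n m : ℕ} [NeZero n] [NeZero m] {q : K}
  [hq : Fact (IsPrimitiveRoot q m)] {z : K} {ν : ℕ}

/-- With $d=\gcd(m,\nu)$ and $e=\gcd(t,\nu/d)$, choose $c$ coprime to $n$ with $ec\equiv t$ modulo
$\nu/d$. Then $z^{ec}/z^t$ is a $d$-th root of unity, so an $m$-th one, so a power of $q$. -/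
theorem nonempty_bialgEquiv_gcd (hz : IsPrimitiveRoot z ν) (hν : ν ∣ n) (t : ℕ) :
    Nonempty (CyclicTaft K n m q (z ^ t) ≃ₐc[K]
      CyclicTaft K n m q (z ^ Nat.gcd t (ν / Nat.gcd m ν))) := by
  have hzn : z ^ n = 1 := (hz.pow_eq_one_iff_dvd n).2 hν
  have hpow : ∀ k : ℕ, (z ^ k) ^ n = 1 := fun k => by rw [← pow_mul, mul_comm, pow_mul, hzn, one_pow]
  have hd : ν / Nat.gcd m ν * Nat.gcd m ν = ν := Nat.div_mul_cancel (Nat.gcd_dvd_right m ν)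
  obtain ⟨c, hc, hct⟩ := exists_coprime_mul_gcd_modEq
    ((Nat.div_dvd_of_dvd (Nat.gcd_dvd_right m ν)).trans hν) t
  set e := Nat.gcd t (ν / Nat.gcd m ν)
  have hz0 : z ≠ 0 := by
    rintro rfl
    simp [NeZero.ne n] at hzn
  have h1 : z ^ (e * c * Nat.gcd m ν) = z ^ (t * Nat.gcd m ν) := by
    have := hct.mul_right' (Nat.gcd m ν)
    rw [hd] at this
    rw [hz.pow_eq_pow_iff (Nat.pos_of_dvd_of_pos hν (NeZero.pos n)), mul_comm e]
    simpa only [mul_comm] using this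
  have h2 : (z ^ (e * c) / z ^ t) ^ m = 1 := by
    obtain ⟨k, hk⟩ := Nat.gcd_dvd_left m ν
    have h3 : (z ^ (e * c) / z ^ t) ^ Nat.gcd m ν = 1 := by
      rw [div_pow, ← pow_mul, ← pow_mul, h1, div_self (pow_ne_zero _ hz0)]
    rw [hk, pow_mul, h3, one_pow]
  obtain ⟨a, -, ha⟩ := hq.out.eq_pow_of_pow_eq_one h2
  refine nonempty_bialgEquiv (hpow t) (hpow e) hc (a := a) ?_
  rw [ha, mul_div_cancel₀ _ (pow_ne_zero _ hz0), pow_mul]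

/-- In $z^{d_2c}=z^{d_1}q^a$ the factor $q^a$ is both an $m$-th and a $\nu$-th root of unity, so
raising to the power $d=\gcd(m,\nu)$ removes it: $d_2cd\equiv d_1d$ modulo $\nu$. Since
$d_2d\mid\nu$, it follows that $d_2d\mid d_1d$. -/
theorem dvd_of_bialgEquiv (hm : 1 < m) (hz : IsPrimitiveRoot z ν) (hν : ν ∣ n) {d₁ d₂ : ℕ}
    (hd₂ : d₂ ∣ ν / Nat.gcd m ν)
    (e : CyclicTaft K n m q (z ^ d₁) ≃ₐc[K] CyclicTaft K n m q (z ^ d₂)) : d₂ ∣ d₁ := by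
  have hzn : z ^ n = 1 := (hz.pow_eq_one_iff_dvd n).2 hν
  have hpow : ∀ k l : ℕ, z ^ l = 1 → (z ^ k) ^ l = 1 := fun k l h => by
    rw [← pow_mul, mul_comm, pow_mul, h, one_pow]
  obtain ⟨a, c, hac⟩ := exists_pow_eq_of_bialgEquiv hm (hpow d₁ n hzn) (hpow d₂ n hzn) e
  have hηm : (q ^ a) ^ m = 1 := by rw [← pow_mul, mul_comm, pow_mul, hq.out.pow_eq_one, one_pow]
  have hην : (q ^ a) ^ ν = 1 := by
    have h1 := congrArg (· ^ ν) hac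
    simp only [mul_pow] at h1
    rw [hpow d₁ ν hz.pow_eq_one, one_mul, ← pow_mul (z ^ d₂), ← pow_mul, ← mul_assoc,
      mul_comm _ ν, pow_mul, hz.pow_eq_one, one_pow] at h1
    exact h1.symm
  have hη : (q ^ a) ^ Nat.gcd m ν = 1 := orderOf_dvd_iff_pow_eq_one.1
    (Nat.dvd_gcd (orderOf_dvd_of_pow_eq_one hηm) (orderOf_dvd_of_pow_eq_one hην))
  have h1 : z ^ (d₂ * c * Nat.gcd m ν) = z ^ (d₁ * Nat.gcd m ν) := by
    rw [pow_mul, pow_mul, hac, mul_pow, hη, mul_one, ← pow_mul]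
  have h2 : d₂ * c * Nat.gcd m ν ≡ d₁ * Nat.gcd m ν [MOD ν] := by
    rwa [hz.pow_eq_pow_iff (Nat.pos_of_dvd_of_pos hν (NeZero.pos n))] at h1
  have h3 : d₂ * Nat.gcd m ν ∣ ν := by
    have := Nat.mul_dvd_mul_right hd₂ (Nat.gcd m ν)
    rwa [Nat.div_mul_cancel (Nat.gcd_dvd_right m ν)] at this
  have h4 : d₂ * Nat.gcd m ν ∣ d₁ * Nat.gcd m ν :=
    (h2.dvd_iff h3).1 ⟨c, by ring⟩
  exact Nat.dvd_of_mul_dvd_mul_right (Nat.gcd_pos_of_pos_left _ (NeZero.pos m)) h4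

end CyclicTaft

end

/-! ### The classification theorem -/

theorem theorem3p5 {K : Type u} [Field K] (n m : ℕ) [NeZero n] [NeZero m] (hn : 2 ≤ n)
    (hm : 3 ≤ m) (q : K) [Fact (IsPrimitiveRoot q m)] (ξ : Kˣ)
    (hξ : Subgroup.zpowers ξ = rootsOfUnity n K) (d : ℕ) (hd : d = Nat.gcd m (nu K n)) :
    (∀ t < nu K n, Nonempty
      (CyclicTaft K n m q ((ξ : K) ^ t) ≃ₐc[K]
        CyclicTaft K n m q ((ξ : K) ^ Nat.gcd t (nu K n / d)))) ∧
    (∀ d₁ d₂ : ℕ, d₁ ∣ nu K n / d → d₂ ∣ nu K n / d → d₁ ≠ d₂ → IsEmpty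
      (CyclicTaft K n m q ((ξ : K) ^ d₁) ≃ₐc[K] CyclicTaft K n m q ((ξ : K) ^ d₂))) ∧
    Nat.card (FactorizingTypes.{u, u} K (Taft K m q) (CyclicGroupAlgebra K n)) =
      ∏ p ∈ (nu K n / d).primeFactors, ((nu K n / d).factorization p + 1) := by
  subst hd
  have hm1 : 1 < m := by omega
  have hord : nu K n = orderOf ξ := by rw [nu, ← hξ, Nat.card_zpowers]
  have hξn : ξ ^ n = 1 := by
    rw [← mem_rootsOfUnity, ← hξ]
    exact Subgroup.mem_zpowers ξ
  have hν : nu K n ∣ n := hord ▸ orderOf_dvd_of_pow_eq_one hξn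
  have hz : IsPrimitiveRoot (ξ : K) (nu K n) :=
    IsPrimitiveRoot.coe_units_iff.2 (hord ▸ IsPrimitiveRoot.orderOf ξ)
  have hN : nu K n / Nat.gcd m (nu K n) ≠ 0 := by
    have h1 : 0 < nu K n := Nat.pos_of_dvd_of_pos hν (NeZero.pos n)
    exact (Nat.div_pos (Nat.le_of_dvd h1 (Nat.gcd_dvd_right _ _))
      (Nat.gcd_pos_of_pos_left _ (NeZero.pos m))).ne'
  have hpow : ∀ k : ℕ, ((ξ : K) ^ k) ^ n = 1 := fun k => by
    rw [← pow_mul, mul_comm, pow_mul, ← Units.val_pow_eq_pow_val, hξn, Units.val_one, one_pow]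
  have part2 : ∀ d₁ d₂ : ℕ, d₁ ∣ nu K n / Nat.gcd m (nu K n) →
      d₂ ∣ nu K n / Nat.gcd m (nu K n) → d₁ ≠ d₂ → IsEmpty
      (CyclicTaft K n m q ((ξ : K) ^ d₁) ≃ₐc[K] CyclicTaft K n m q ((ξ : K) ^ d₂)) := by
    refine fun d₁ d₂ h₁ h₂ hne => ⟨fun e => hne ?_⟩
    exact Nat.dvd_antisymm (CyclicTaft.dvd_of_bialgEquiv hm1 hz hν h₁ e.symm)
      (CyclicTaft.dvd_of_bialgEquiv hm1 hz hν h₂ e)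
  refine ⟨fun t _ => CyclicTaft.nonempty_bialgEquiv_gcd hz hν t, part2, ?_⟩
  -- The product counts the divisors of $\nu(n)/d$, so it suffices that $e\mapsto T^{\xi^e}$ is a
  -- bijection from these divisors to the isomorphism types.
  rw [← Nat.card_divisors hN, ← Nat.card_eq_finsetCard]
  let F : (Nat.divisors (nu K n / Nat.gcd m (nu K n))) →
      FactorizingTypes.{u, u} K (Taft K m q) (CyclicGroupAlgebra K n) := fun e =>
    Quotient.mk _ ⟨HopfAlgCat.of K (CyclicTaft K n m q ((ξ : K) ^ (e : ℕ))),
      CyclicTaft.factorizesThrough (hpow e)⟩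
  refine (Nat.card_eq_of_bijective F ⟨?_, ?_⟩).symm
  · intro e₁ e₂ h
    by_contra hne
    obtain ⟨f⟩ := Quotient.exact h
    exact (part2 e₁ e₂ (Nat.dvd_of_mem_divisors e₁.2) (Nat.dvd_of_mem_divisors e₂.2)
      fun h => hne (Subtype.ext h)).false f
  · intro Q
    induction Q using Quotient.inductionOn with
    | h E =>
      obtain ⟨T⟩ := E.2.exists_taftBasis
      obtain ⟨ω, hω, ⟨f⟩⟩ := T.exists_bialgEquiv hm1
      -- The parameter is a root of unity, hence $\xi^t$ with $t\ge0$; the first claim then replaces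
      -- $t$ by a divisor of $\nu(n)/d$.
      obtain ⟨η, rfl⟩ : IsUnit ω := IsUnit.of_pow_eq_one hω (NeZero.ne n)
      have hη : η ∈ Subgroup.zpowers ξ := by
        rw [hξ, mem_rootsOfUnity]
        exact Units.ext (by simpa using hω)
      have hfin : IsOfFinOrder ξ := isOfFinOrder_iff_pow_eq_one.2 ⟨n, NeZero.pos n, hξn⟩
      obtain ⟨t, rfl⟩ := (hfin.mem_powers_iff_mem_zpowers).2 hη
      rw [Units.val_pow_eq_pow_val] at f
      obtain ⟨f'⟩ := CyclicTaft.nonempty_bialgEquiv_gcd (m := m) (q := q) hz hν t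
      refine ⟨⟨_, Nat.mem_divisors.2 ⟨Nat.gcd_dvd_right t _, hN⟩⟩, Quotient.sound ?_⟩
      exact ⟨f'.symm.trans f⟩
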